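/- **Setting.** Let $d\ge 1$, and let $\Lambda$ be a finite set of $n\ge 1$ sites of the $d$-dimensional square lattice $\mathbb{Z}^d\subset\mathbb{R}^d$ (for instance a cube), with one qubit at each site. A *power-law Hamiltonian* on $\Lambda$ with exponent $\alpha$ is $H=\sum_{i,j\in\Lambda}H_{i,j}$, where each $H_{i,j}$ is Hermitian, acts nontrivially only on the qubits $i,j$, and satisfies (in spectral norm) $\|H_{i,i}\|\le 1$ and $\|H_{i,j}\|\le \|i-j\|_2^{-\alpha}$ for $i\ne j$. Its truncation at range $\ell$ is $\widetilde H=\sum_{\|i-j\|_2\le \ell}H_{i,j}$. For a Hamiltonian $\sum_{\gamma=1}^{\Gamma}H_\gamma$, a *$p$th-order product formula* with $\Upsilon$ stages is $\mathscr{S}(t)=\prod_{\upsilon=1}^{\Upsilon}\prod_{\gamma=1}^{\Gamma}e^{-it\,a_{(\upsilon,\gamma)}H_{\pi_\upsilon(\gamma)}}$ (factors with increasing indices from right to left), with real $|a_{(\upsilon,\gamma)}|\le 1$ and permutations $\pi_\upsilon$, such that $\mathscr{S}(t)=e^{-it\sum_\gamma H_\gamma}+O(t^{p+1})$ as $t\to0$;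 for $H$ and $\widetilde H$ the summands are the (retained) $H_{i,j}$. A *gate* is a unitary acting nontrivially on at most two qubits. Below $p\ge1$, $\Upsilon\ge0$, $t\ge 0$ and $\epsilon>0$. All constants in $\mathcal{O}(\cdot)$ depend only on $d,\alpha,p,\Upsilon$ unless stated otherwise, and not on $\Lambda$, $n$, $H$, $t$, $\epsilon$, $\ell$ or the choice of formula. **Theorem, part 1 (no truncation).** Let $\alpha\ge 0$, let $H$ be a power-law Hamiltonian with exponent $\alpha$, and let $\mathscr{S}$ be a $p$th-order product formula for $H$. Then $$\|\mathscr{S}(t)-e^{-itH}\|=\begin{cases}\mathcal{O}\big(n^{1+(p+1)(1-\alpha/d)}t^{p+1}\big), & 0\le\alpha<d,\\ \mathcal{O}\big(n(\log n)^{p+1}t^{p+1}\big), & \alpha=d,\\ \mathcal{O}\big(nt^{p+1}\big), & \alpha>d.\end{cases}$$ Consequently $\|\mathscr{S}(t/r)^r-e^{-itH}\|\le\epsilon$ for every integer $r\ge1$ that is at least a suitable constant times $$\begin{cases} n^{1-\frac{\alpha}{d}+\frac1p(2-\frac{\alpha}{d})}t^{1+\frac1p}/\epsilon^{\frac1p},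 & 0\le\alpha<d,\\ n^{\frac1p}(\log n)^{1+\frac1p}t^{1+\frac1p}/\epsilon^{\frac1p}, & \alpha=d,\\ n^{\frac1p}t^{1+\frac1p}/\epsilon^{\frac1p}, & \alpha>d.\end{cases}$$ Each Trotter step $\mathscr{S}(s)$ is implemented exactly by $\mathcal{O}(n^2)$ gates (constant depending only on $\Upsilon, d,\alpha$). For constant $\epsilon$ the resulting gate complexity is $n^{3-\alpha/d+o(1)}t^{1+o(1)}$ if $0\le\alpha<d$ and $n^{2+o(1)}t^{1+o(1)}$ if $\alpha\ge d$. That is: for every $\delta>0$ there is $p_0$ such that for all $p\ge p_0$ and all $\Upsilon$, $\epsilon>0$, $t_0>0$ there is a constant $C$ such that, for all $\Lambda$, $H$, every $p$th-order $\Upsilon$-stage formula $\mathscr{S}$ for $H$ and all $t\ge t_0$, there are an integer $r\ge1$ with $\|\mathscr{S}(t/r)^r-e^{-itH}\|\le\epsilon$ and a circuit implementing $\mathscr{S}(t/r)^r$ exactly with at most $C\,n^{3-\alpha/d+\delta}t^{1+\delta}$ (respectively $C\,n^{2+\delta}t^{1+\delta}$) gates. **Theorem, part 2 (truncation).** Let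 $\alpha>d$, let $H$ be a power-law Hamiltonian with exponent $\alpha$, let $\widetilde H$ be its truncation at range $\ell$, and let $\mathscr{S}$ be a $p$th-order product formula for $\widetilde H$. Then $$\|\mathscr{S}(t)-e^{-it\widetilde H}\|=\mathcal{O}(nt^{p+1}).$$ For $\ell\ge1$ each Trotter step $\mathscr{S}(s)$ is implemented exactly by $\mathcal{O}(n\ell^d)$ gates (constant depending only on $\Upsilon,d,\alpha$). Moreover there is $c_0>0$, depending only on $d$ and $\alpha$, such that: 1. $\|\mathscr{S}(t/r)^r-e^{-itH}\|\le\epsilon$ whenever $\ell\ge c_0(nt/\epsilon)^{1/(\alpha-d)}$ and the integer $r\ge1$ is at least a suitable constant times $n^{1/p}t^{1+1/p}/\epsilon^{1/p}$; 2. with cutoff $\ell=\Theta\big((nt/\epsilon)^{1/(\alpha-d)}\big)$ and constant $\epsilon$ the gate complexity of simulating $H$ is $(nt)^{1+\frac{d}{\alpha-d}+o(1)}$. That is: for every $\delta>0$ there is $p_0$ such that for all $p\ge p_0$ and all $\Upsilon$, $\epsilon>0$, $t_0>0$, $c_1\ge c_0$ there is a constant $C$ such that, for all $\Lambda$, $H$,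 all $t\ge t_0$, all $\ell$ with $c_0(nt/\epsilon)^{1/(\alpha-d)}\le\ell\le c_1(nt/\epsilon)^{1/(\alpha-d)}$ and every $p$th-order $\Upsilon$-stage formula $\mathscr{S}$ for $\widetilde H$, there are an integer $r\ge1$ with $\|\mathscr{S}(t/r)^r-e^{-itH}\|\le\epsilon$ and a circuit implementing $\mathscr{S}(t/r)^r$ exactly with at most $C\,(nt)^{1+\frac{d}{\alpha-d}+\delta}$ gates. **Existence of formulas.** For every $p$ there is $\Upsilon$ such that for any number of summands there is an $\Upsilon$-stage product formula (with $|a_{(\upsilon,\gamma)}|\le1$) which has order $p$ for all choices of the summands; so the gate complexities above are attained. -/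

import Mathlib

open scoped Matrix.Norms.L2Operator Topology

/-- Operators on the Hilbert space `(ℂ²)^{⊗S}` of qubits labelled by `S`, as matrices in the
computational basis `S → Fin 2`. The norm in force on them is the spectral norm. -/
abbrev QubitOp (S : Type*) [Fintype S] [DecidableEq S] : Type _ :=
  Matrix (S → Fin 2) (S → Fin 2) ℂ

/-- `A` acts nontrivially only on the qubits in `X`: it is `a ⊗ 1` for an operator `a` on the
qubits in `X` and the identity on all the other qubits. -/
def SupportedOn {S : Type*} [Fintype S] [DecidableEq S] (X : Finset S) (A : QubitOp S) : Prop :=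
  ∃ a : QubitOp X, ∀ x y : S → Fin 2,
    ((∀ k, k ∉ X → x k = y k) → A x y = a (fun k => x k) (fun k => y k)) ∧
    (¬ (∀ k, k ∉ X → x k = y k) → A x y = 0)

/-- A gate: a unitary operator that acts nontrivially on at most two qubits. -/
def IsGate {S : Type*} [Fintype S] [DecidableEq S] (U : QubitOp S) : Prop :=
  U ∈ unitary (QubitOp S) ∧ ∃ i j : S, SupportedOn {i, j} U

/-- The circuit `c` (a list of gates, whose length is the gate count) implements `U` exactly. -/
def Implements {S : Type*} [Fintype S] [DecidableEq S] (c : List (QubitOp S)) (U : QubitOp S) :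
    Prop :=
  (∀ g ∈ c, IsGate g) ∧ c.prod = U

/-- Euclidean distance of two sites of the square lattice `ℤ^d`. -/
noncomputable def siteDist {d : ℕ} (i j : Fin d → ℤ) : ℝ :=
  Real.sqrt (∑ k, ((i k : ℝ) - (j k : ℝ)) ^ 2)

/-- The family `H i j` consists of the terms of a power-law Hamiltonian with exponent `α` on `Λ`,
with one qubit at every site of `Λ`. -/
structure IsPowerLaw {d : ℕ} (α : ℝ) (Λ : Finset (Fin d → ℤ)) (H : Λ × Λ → QubitOp Λ) : Prop where
  hermitian : ∀ q, (H q).IsHermitian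
  supported : ∀ q : Λ × Λ, SupportedOn {q.1, q.2} (H q)
  norm_diag : ∀ i : Λ, ‖H (i, i)‖ ≤ 1
  norm_offdiag : ∀ i j : Λ, i ≠ j → ‖H (i, j)‖ ≤ 1 / siteDist (i : Fin d → ℤ) j ^ α

open Classical in
/-- The pairs of sites at distance at most `ℓ`. They index the summands of the truncated
Hamiltonian. -/
noncomputable def nearPairs {d : ℕ} (Λ : Finset (Fin d → ℤ)) (ℓ : ℝ) : Finset (Λ × Λ) :=
  Finset.univ.filter fun q => siteDist (q.1 : Fin d → ℤ) q.2 ≤ ℓ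

/-- A product formula with `Υ` stages for summands indexed by `ι`: an ordering of the summands in
every stage, and real coefficients bounded by `1` in absolute value. -/
structure ProductFormula (Υ : ℕ) (ι : Type*) [Fintype ι] where
  /-- the ordering of the summands in each stage -/
  order : Fin Υ → (Fin (Fintype.card ι) ≃ ι)
  /-- the coefficients -/
  coeff : Fin Υ → Fin (Fintype.card ι) → ℝ
  coeff_le : ∀ υ γ, |coeff υ γ| ≤ 1

namespace ProductFormula

variable {Υ : ℕ} {ι : Type*} [Fintype ι] {S : Type*} [Fintype S] [DecidableEq S]

/-- The operator `∏_υ ∏_γ exp (t a_{υ,γ} K_{π_υ(γ)})`, where the indices `υ` and `γ` both increase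
from right to left. -/
noncomputable def eval (F : ProductFormula Υ ι) (K : ι → QubitOp S) (t : ℝ) : QubitOp S :=
  (List.ofFn fun υ : Fin Υ =>
    (List.ofFn fun γ : Fin (Fintype.card ι) =>
      NormedSpace.exp (((t * F.coeff υ γ : ℝ) : ℂ) • K (F.order υ γ))).reverse.prod).reverse.prod

/-- The formula has order `p` for the summands `K`: it agrees with `exp (t ∑ K)` up to an error
`O(t^(p+1))` as `t → 0`. -/
def HasOrder (F : ProductFormula Υ ι) (p : ℕ) (K : ι → QubitOp S) : Prop :=
  (fun t : ℝ => F.eval K t - NormedSpace.exp ((t : ℂ) • ∑ i, K i))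
    =O[𝓝 0] (fun t : ℝ => t ^ (p + 1))

end ProductFormula

/-- The anti-Hermitian generators `-i H` of real-time evolution. -/
noncomputable def generators {S ι : Type*} [Fintype S] [DecidableEq S] (H : ι → QubitOp S) :
    ι → QubitOp S :=
  fun q => (-Complex.I) • H q

/-- The real-time evolution `exp (-i t ∑ H)`. -/
noncomputable def evolution {S ι : Type*} [Fintype S] [DecidableEq S] [Fintype ι]
    (H : ι → QubitOp S) (t : ℝ) : QubitOp S :=
  NormedSpace.exp ((-(Complex.I * (t : ℂ))) • ∑ q, H q)

/-- The restriction of the family of summands to the pairs at distance at most `ℓ`. -/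
def truncate {d : ℕ} {Λ : Finset (Fin d → ℤ)} (H : Λ × Λ → QubitOp Λ) (ℓ : ℝ) :
    nearPairs Λ ℓ → QubitOp Λ :=
  fun q => H q

/-- Scaling of the Trotter error for power-law interactions. -/
noncomputable def errorRate (d : ℕ) (α : ℝ) (p n : ℕ) (t : ℝ) : ℝ :=
  if α < d then (n : ℝ) ^ (1 + ((p : ℝ) + 1) * (1 - α / d)) * t ^ (p + 1)
  else if α = d then (n : ℝ) * Real.log n ^ (p + 1) * t ^ (p + 1)
  else (n : ℝ) * t ^ (p + 1)

/-- Scaling of the Trotter number for power-law interactions. -/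
noncomputable def stepRate (d : ℕ) (α : ℝ) (p n : ℕ) (t ε : ℝ) : ℝ :=
  if α < d then
    (n : ℝ) ^ (1 - α / d + 1 / (p : ℝ) * (2 - α / d)) * t ^ (1 + 1 / (p : ℝ)) / ε ^ (1 / (p : ℝ))
  else if α = d then
    (n : ℝ) ^ (1 / (p : ℝ)) * Real.log n ^ (1 + 1 / (p : ℝ)) * t ^ (1 + 1 / (p : ℝ))
      / ε ^ (1 / (p : ℝ))
  else (n : ℝ) ^ (1 / (p : ℝ)) * t ^ (1 + 1 / (p : ℝ)) / ε ^ (1 / (p : ℝ))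

/-- Scaling of the gate count for power-law interactions, with `δ` in place of `o(1)`. -/
noncomputable def gateRate (d : ℕ) (α δ : ℝ) (n : ℕ) (t : ℝ) : ℝ :=
  if α < d then (n : ℝ) ^ (3 - α / d + δ) * t ^ (1 + δ)
  else (n : ℝ) ^ (2 + δ) * t ^ (1 + δ)

/-! ### Products of exponentials and Taylor remainders in nested commutators -/

section TrotterTheory

variable {𝔸 : Type*} [CStarAlgebra 𝔸]

/-! The Trotter error is controlled by nested commutators of the summands, and locality makes most
of these vanish.

Let `S t = exp (t A_N) ⋯ exp (t A_1)` with skew-adjoint `A_j`, and let `K` be the exact generator.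
Then `S' = G S`, where `G` is the sum of the `A_j`, each conjugated by the unitary product of the
factors to its left. Taylor expansion of these conjugations to degree `p` leaves a remainder of at
most `t ^ p` times a sum of norms of `p`-fold nested commutators (`exists_conj_trotter_taylor`,
`exists_trotterGen_taylor`). The order condition says that `G - K = O(t ^ p)` at `0`, so all Taylor
coefficients of `G - K` below degree `p` vanish, whatever their formulas, and the remainder bound
becomes a bound of `G - K` for every `t ≥ 0`. Variation of constants turns it into a bound of `S t -
exp (t K)` without any smallness of `t` (`norm_trotter_sub_exp_le`).

A two-site operator commutes with everything supported elsewhere. If the summands touching any one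
site have total norm at most `h`, a nested commutator supported on `m` sites meets summands of total
norm at most `m h`, and the sum over all starting terms is at most a constant times `n h ^ (p + 1)`
(`sum_commSum_le_of_supportedOn`). For a power law, `h` is a lattice sum. Ranking the sites by their
distance compares it with `∑ k ^ (-(α / d))`, hence the three regimes `n ^ (1 - α / d)`, `log n` and
`1` (`exists_row_sum_le`).

Trotter numbers come from solving `r · (error of a step of length t / r) ≤ ε` for `r`; gate counts
multiply by the number of retained pairs. Truncation costs `n t ℓ ^ (d - α)`, by the tail of the
same lattice sum (`exists_tail_sum_le`, `exists_cutoff`). Formulas of every order are built by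
raising the order by one at a time, with a time-symmetric composition or with Suzuki's five-fold
composition according to the parity of the leading error (`exists_stages`). -/

theorem hasDerivAt_exp_ofReal_smul (A : 𝔸) (t : ℝ) :
    HasDerivAt (fun t : ℝ => NormedSpace.exp ((t : ℂ) • A))
      (A * NormedSpace.exp ((t : ℂ) • A)) t := by
  simpa only [Complex.coe_smul] using hasDerivAt_exp_smul_const' (𝕂 := ℝ) A t

theorem ofReal_smul_mem_skewAdjoint {A : 𝔸} (hA : A ∈ skewAdjoint 𝔸) (t : ℝ) :
    (t : ℂ) • A ∈ skewAdjoint 𝔸 := by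
  rw [Complex.coe_smul]
  exact skewAdjoint.smul_mem t hA

theorem exp_ofReal_smul_mem_unitary {A : 𝔸} (hA : A ∈ skewAdjoint 𝔸) (t : ℝ) :
    NormedSpace.exp ((t : ℂ) • A) ∈ unitary 𝔸 :=
  let : NormedAlgebra ℚ 𝔸 := .restrictScalars ℚ ℂ 𝔸
  NormedSpace.exp_mem_unitary_of_mem_skewAdjoint (ofReal_smul_mem_skewAdjoint hA t)

theorem star_exp_ofReal_smul {A : 𝔸} (hA : A ∈ skewAdjoint 𝔸) (t : ℝ) :
    star (NormedSpace.exp ((t : ℂ) • A)) = NormedSpace.exp ((t : ℂ) • -A) := by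
  rw [NormedSpace.star_exp, skewAdjoint.mem_iff.mp (ofReal_smul_mem_skewAdjoint hA t), smul_neg]

/-- The product `exp (t A_N) ⋯ exp (t A_1)` for the list `[A_1, …, A_N]`. -/
noncomputable def trotter : List 𝔸 → ℝ → 𝔸
  | [], _ => 1
  | A :: L, t => trotter L t * NormedSpace.exp ((t : ℂ) • A)

theorem trotter_mem_unitary {L : List 𝔸} (hL : ∀ A ∈ L, A ∈ skewAdjoint 𝔸) (t : ℝ) :
    trotter L t ∈ unitary 𝔸 := by
  induction L with
  | nil => exact one_mem _
  | cons A L ih =>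
    exact mul_mem (ih fun B hB => hL B (List.mem_cons_of_mem _ hB))
      (exp_ofReal_smul_mem_unitary (hL A List.mem_cons_self) t)

theorem trotter_append (L M : List 𝔸) (t : ℝ) :
    trotter (L ++ M) t = trotter M t * trotter L t := by
  induction L with
  | nil => simp [trotter]
  | cons A L ih => simp [trotter, ih, mul_assoc]

theorem trotter_zero (L : List 𝔸) : trotter L 0 = 1 := by
  induction L with
  | nil => rfl
  | cons A L ih => simp [trotter, ih]

/-- Sum of the norms of the nested commutators `[A_{i_p}, …, [A_{i_1}, B]]` over all words of
length `p` in the list `L`. -/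
noncomputable def commSum (L : List 𝔸) : ℕ → 𝔸 → ℝ
  | 0, B => ‖B‖
  | p + 1, B => (L.map fun A => commSum L p ⁅A, B⁆).sum

theorem commSum_nonneg (L : List 𝔸) (p : ℕ) (B : 𝔸) : 0 ≤ commSum L p B := by
  induction p generalizing B with
  | zero => exact norm_nonneg B
  | succ p ih =>
    refine List.sum_nonneg ?_
    simp only [List.mem_map]
    rintro _ ⟨A, -, rfl⟩
    exact ih _

theorem commSum_zero (L : List 𝔸) (p : ℕ) : commSum L p 0 = 0 := by
  induction p with
  | zero => exact norm_zero
  | succ p ih => simp [commSum, Ring.lie_def, ih]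

theorem commSum_le_cons (A : 𝔸) (L : List 𝔸) (p : ℕ) (B : 𝔸) :
    commSum L p B ≤ commSum (A :: L) p B := by
  induction p generalizing B with
  | zero => exact le_rfl
  | succ p ih =>
    simp only [commSum, List.map_cons, List.sum_cons]
    exact (List.sum_le_sum fun A' _ => ih ⁅A', B⁆).trans
      (le_add_of_nonneg_left (commSum_nonneg _ _ _))

/-- Words are split by the letter applied first: either it is the head `A`, or it lies in `L`, and
then only words entirely in `L` are kept. -/
theorem commSum_add_le_cons (A : 𝔸) (L : List 𝔸) (p : ℕ) (B : 𝔸) :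
    commSum L (p + 1) B + commSum (A :: L) p ⁅A, B⁆ ≤ commSum (A :: L) (p + 1) B := by
  simp only [commSum, List.map_cons, List.sum_cons]
  rw [add_comm]
  gcongr
  exact List.sum_le_sum fun A' _ => commSum_le_cons A L p ⁅A', B⁆

/-- The left side runs over the words that apply `A` exactly `k` times and only then letters of `L`.
These are distinct words over `A :: L`, and they are the ones produced by expanding the conjugation
by `exp (τ A)` first. -/
theorem sum_commSum_le_cons (A : 𝔸) (L : List 𝔸) (p : ℕ) (B : 𝔸) :
    (∑ k ∈ Finset.range p, commSum L (p - k) ((fun C => ⁅A, C⁆)^[k] B)) +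
      ‖(fun C => ⁅A, C⁆)^[p] B‖ ≤ commSum (A :: L) p B := by
  induction p generalizing B with
  | zero => simp [commSum]
  | succ p ih =>
    rw [Finset.sum_range_succ']
    refine le_trans ?_ (commSum_add_le_cons A L p B)
    have := ih ⁅A, B⁆
    simp only [Function.iterate_succ_apply, Nat.add_sub_add_right, Function.iterate_zero, id,
      Nat.sub_zero]
    linarith

/-- Taylor expansion of `exp (τ A) B exp (-τ A)` with a commutator bound of the remainder. -/
theorem norm_exp_conj_sub_taylor_le {A : 𝔸} (hA : A ∈ skewAdjoint 𝔸) (p : ℕ) (B : 𝔸) {τ : ℝ}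
    (hτ : 0 ≤ τ) :
    ‖NormedSpace.exp ((τ : ℂ) • A) * B * NormedSpace.exp ((τ : ℂ) • -A) -
      ∑ k ∈ Finset.range p, (τ ^ k / k.factorial) • (fun C => ⁅A, C⁆)^[k] B‖ ≤
      τ ^ p / p.factorial * ‖(fun C => ⁅A, C⁆)^[p] B‖ := by
  induction p generalizing B τ with
  | zero =>
    -- Without Taylor terms the claim is that conjugation by a unitary preserves the norm.
    rw [← star_exp_ofReal_smul hA]
    have hU := exp_ofReal_smul_mem_unitary hA τ
    rw [Finset.range_zero, Finset.sum_empty, sub_zero,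
      CStarRing.norm_mul_mem_unitary _ (Unitary.star_mem hU), CStarRing.norm_mem_unitary_mul _ hU]
    simp
  | succ p ih =>
    set R : ℝ → 𝔸 := fun s => NormedSpace.exp ((s : ℂ) • A) * B * NormedSpace.exp ((s : ℂ) • -A) -
      ∑ k ∈ Finset.range (p + 1), (s ^ k / k.factorial) • (fun C => ⁅A, C⁆)^[k] B with hR
    set R' : ℝ → 𝔸 := fun s =>
      NormedSpace.exp ((s : ℂ) • A) * ⁅A, B⁆ * NormedSpace.exp ((s : ℂ) • -A) -
      ∑ k ∈ Finset.range p, (s ^ k / k.factorial) • (fun C => ⁅A, C⁆)^[k] ⁅A, B⁆ with hR'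
    have hpow : ∀ (k : ℕ) (s : ℝ), HasDerivAt (fun s : ℝ => s ^ (k + 1) / (k + 1).factorial)
        (s ^ k / k.factorial) s := by
      intro k s
      have := (hasDerivAt_pow (k + 1) s).div_const ((k + 1).factorial : ℝ)
      refine this.congr_deriv ?_
      rw [Nat.factorial_succ]
      push_cast
      field_simp
    -- The derivative of the remainder for `B` is the remainder of one degree less for `⁅A, B⁆`, so
    -- the induction hypothesis bounds it and integration gives the claim.
    have hderiv : ∀ s, HasDerivAt R (R' s) s := by
      intro s
      have h1 := ((hasDerivAt_exp_ofReal_smul A s).mul_const B).mul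
        (hasDerivAt_exp_ofReal_smul (-A) s)
      have h2 : HasDerivAt (fun s : ℝ => ∑ k ∈ Finset.range (p + 1),
          (s ^ k / k.factorial) • (fun C => ⁅A, C⁆)^[k] B)
          (∑ k ∈ Finset.range p, (s ^ k / k.factorial) • (fun C => ⁅A, C⁆)^[k] ⁅A, B⁆) s := by
        simp_rw [Finset.sum_range_succ']
        simp only [Function.iterate_succ_apply, pow_zero]
        exact (HasDerivAt.fun_sum fun k _ => (hpow k s).smul_const _).add_const _
      refine (h1.sub h2).congr_deriv ?_
      have hc : A * NormedSpace.exp ((s : ℂ) • A) = NormedSpace.exp ((s : ℂ) • A) * A :=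
        (((Commute.refl A).smul_right (s : ℂ)).exp_right).eq
      simp only [hR', Ring.lie_def, hc]
      noncomm_ring
    have hbound := image_norm_le_of_norm_deriv_right_le_deriv_boundary
      (f := R) (f' := R') (a := 0) (b := τ)
      (B := fun s => s ^ (p + 1) / (p + 1).factorial * ‖(fun C => ⁅A, C⁆)^[p + 1] B‖)
      (B' := fun s => s ^ p / p.factorial * ‖(fun C => ⁅A, C⁆)^[p + 1] B‖)
      (fun s _ => (hderiv s).continuousAt.continuousWithinAt)
      (fun s _ => (hderiv s).hasDerivWithinAt) ?_ (fun s => (hpow p s).mul_const _) ?_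
      (Set.right_mem_Icc.2 hτ)
    · exact hbound
    · simp [hR, Finset.sum_range_succ']
    · intro s hs
      exact ih ⁅A, B⁆ hs.1

/-- Taylor expansion of the conjugation by a product of exponentials, with a remainder bounded by
nested commutators. -/
theorem exists_conj_trotter_taylor {L : List 𝔸} (hL : ∀ A ∈ L, A ∈ skewAdjoint 𝔸) (p : ℕ)
    (B : 𝔸) :
    ∃ c : ℕ → 𝔸, ∀ τ : ℝ, 0 ≤ τ →
      ‖trotter L τ * B * star (trotter L τ) - ∑ k ∈ Finset.range p, τ ^ k • c k‖ ≤
        τ ^ p * commSum L p B := by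
  induction L generalizing p B with
  | nil =>
    cases p with
    | zero => exact ⟨0, fun τ _ => by simp [trotter, commSum]⟩
    | succ p =>
      refine ⟨fun k => if k = 0 then B else 0, fun τ _ => ?_⟩
      simp [trotter, commSum]
  | cons A L ih =>
    have hA := hL A List.mem_cons_self
    have hL' := fun B hB => hL B (List.mem_cons_of_mem A hB)
    -- Coefficients are needed for every degree and every operator, because the `k`-th term of the
    -- expansion in `A` is expanded only to degree `p - k`.
    choose c hc using fun (q : ℕ) (C : 𝔸) => ih hL' q C
    set D : ℕ → 𝔸 := fun k => (fun C => ⁅A, C⁆)^[k] B with hD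
    refine ⟨fun m => ∑ k ∈ Finset.range (m + 1),
      (1 / (k.factorial : ℝ)) • c (p - k) (D k) (m - k), fun τ hτ => ?_⟩
    have hU := trotter_mem_unitary hL' τ
    set U := trotter L τ with hUdef
    have hreidx : ∑ m ∈ Finset.range p, τ ^ m • ∑ k ∈ Finset.range (m + 1),
        (1 / (k.factorial : ℝ)) • c (p - k) (D k) (m - k) =
        ∑ k ∈ Finset.range p, (τ ^ k / k.factorial) •
          ∑ j ∈ Finset.range (p - k), τ ^ j • c (p - k) (D k) j := by
      simp_rw [Finset.smul_sum, smul_smul]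
      rw [Finset.sum_sigma', Finset.sum_sigma']
      refine Finset.sum_bij' (fun x _ => ⟨x.2, x.1 - x.2⟩) (fun x _ => ⟨x.1 + x.2, x.1⟩)
        ?_ ?_ ?_ ?_ ?_
      · rintro ⟨m, k⟩ h
        simp only [Finset.mem_sigma, Finset.mem_range] at h ⊢
        omega
      · rintro ⟨k, j⟩ h
        simp only [Finset.mem_sigma, Finset.mem_range] at h ⊢
        omega
      · rintro ⟨m, k⟩ h
        simp only [Finset.mem_sigma, Finset.mem_range] at h
        simp only [Sigma.mk.injEq, heq_eq_eq, and_true]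
        omega
      · rintro ⟨k, j⟩ h
        simp
      · rintro ⟨m, k⟩ h
        simp only [Finset.mem_sigma, Finset.mem_range] at h
        have : m = k + (m - k) := by omega
        congr 1
        conv_lhs => rw [this, pow_add]
        ring
    -- The error has two sources: the remainder of the inner conjugation by `exp (τ A)`, carried
    -- along isometrically by `U`, and the remainders of the outer conjugations of the terms `D k`.
    have hsplit : trotter (A :: L) τ * B * star (trotter (A :: L) τ) -
        ∑ m ∈ Finset.range p, τ ^ m • ∑ k ∈ Finset.range (m + 1),
          (1 / (k.factorial : ℝ)) • c (p - k) (D k) (m - k) =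
        U * (NormedSpace.exp ((τ : ℂ) • A) * B * NormedSpace.exp ((τ : ℂ) • -A) -
          ∑ k ∈ Finset.range p, (τ ^ k / k.factorial) • D k) * star U +
        ∑ k ∈ Finset.range p, (τ ^ k / k.factorial) •
          (U * D k * star U - ∑ j ∈ Finset.range (p - k), τ ^ j • c (p - k) (D k) j) := by
      rw [hreidx, trotter, star_mul, star_exp_ofReal_smul hA]
      simp only [mul_sub, sub_mul, smul_sub, Finset.sum_sub_distrib, Finset.mul_sum,
        Finset.sum_mul, mul_smul_comm, smul_mul_assoc, ← hUdef]
      noncomm_ring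
    rw [hsplit]
    refine (norm_add_le _ _).trans ?_
    rw [CStarRing.norm_mul_mem_unitary _ (Unitary.star_mem hU),
      CStarRing.norm_mem_unitary_mul _ hU]
    have hfac : ∀ k : ℕ, τ ^ k / k.factorial ≤ τ ^ k := fun k =>
      div_le_self (by positivity) (by exact_mod_cast Nat.one_le_iff_ne_zero.2 k.factorial_ne_zero)
    have h1 := norm_exp_conj_sub_taylor_le hA p B hτ
    have h2 : ‖∑ k ∈ Finset.range p, (τ ^ k / k.factorial) •
          (U * D k * star U - ∑ j ∈ Finset.range (p - k), τ ^ j • c (p - k) (D k) j)‖ ≤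
        ∑ k ∈ Finset.range p, τ ^ p * commSum L (p - k) (D k) := by
      refine norm_sum_le_of_le _ fun k hk => ?_
      rw [Finset.mem_range] at hk
      rw [norm_smul, Real.norm_of_nonneg (by positivity)]
      calc τ ^ k / k.factorial * _ ≤ τ ^ k * (τ ^ (p - k) * commSum L (p - k) (D k)) := by
            gcongr
            · exact hfac k
            · exact hc (p - k) (D k) τ hτ
        _ = τ ^ p * commSum L (p - k) (D k) := by
            rw [← mul_assoc, ← pow_add, Nat.add_sub_cancel' hk.le]
    have h3 := sum_commSum_le_cons A L p B
    calc _ ≤ τ ^ p * ‖D p‖ + ∑ k ∈ Finset.range p, τ ^ p * commSum L (p - k) (D k) := by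
          refine add_le_add (h1.trans ?_) h2
          exact mul_le_mul_of_nonneg_right (hfac p) (norm_nonneg _)
      _ = τ ^ p * ((∑ k ∈ Finset.range p, commSum L (p - k) (D k)) + ‖D p‖) := by
          rw [← Finset.mul_sum]; ring
      _ ≤ _ := by gcongr

end TrotterTheory

/-! ### Vanishing orders of analytic functions and polynomials -/

section Factorization

variable {E : Type*} [NormedAddCommGroup E] [NormedSpace ℝ E]

/-- An analytic function that is `O(t ^ k)` is `t ^ k` times an analytic function. -/
theorem AnalyticAt.exists_eq_pow_smul_of_isBigO {f : ℝ → E} (hf : AnalyticAt ℝ f 0) {k : ℕ}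
    (hO : f =O[𝓝 0] fun t : ℝ => t ^ k) :
    ∃ g : ℝ → E, AnalyticAt ℝ g 0 ∧ ∀ᶠ t in 𝓝 0, f t = t ^ k • g t := by
  induction k with
  | zero => exact ⟨f, hf, by simp⟩
  | succ k ih =>
    have hpow : (fun t : ℝ => t ^ (k + 1)) =O[𝓝 0] fun t : ℝ => t ^ k :=
      (Asymptotics.isLittleO_pow_pow (Nat.lt_succ_self k)).isBigO
    obtain ⟨g, hg, hfg⟩ := ih (hO.trans hpow)
    -- Dividing the stronger bound by `t ^ k` away from `0` gives `‖g t‖ ≤ c ‖t‖`, and `g` is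
    -- continuous; hence one more factor `t` splits off.
    have hg0 : g 0 = 0 := by
      obtain ⟨c, hc⟩ := hO.bound
      have h1 : Filter.Tendsto (fun t : ℝ => ‖g t‖) (𝓝[≠] 0) (𝓝 ‖g 0‖) :=
        hg.continuousAt.norm.tendsto.mono_left nhdsWithin_le_nhds
      have h2 : Filter.Tendsto (fun t : ℝ => c * ‖t‖) (𝓝[≠] 0) (𝓝 0) := by
        have : Continuous fun t : ℝ => c * ‖t‖ := by fun_prop
        simpa using (this.tendsto 0).mono_left nhdsWithin_le_nhds
      have h3 : ∀ᶠ t in 𝓝[≠] (0 : ℝ), ‖g t‖ ≤ c * ‖t‖ := by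
        filter_upwards [nhdsWithin_le_nhds hc, nhdsWithin_le_nhds hfg, self_mem_nhdsWithin]
          with t h h' ht
        have ht0 : 0 < ‖t‖ ^ k := pow_pos (norm_pos_iff.2 ht) k
        rw [h', norm_smul, norm_pow, norm_pow, pow_succ] at h
        nlinarith
      exact norm_le_zero_iff.1 (le_of_tendsto_of_tendsto h1 h2 h3)
    have hord : ((1 : ℕ) : ℕ∞) ≤ analyticOrderAt g 0 := by
      rw [Nat.cast_one, Order.one_le_iff_ne_zero, Ne, hg.analyticOrderAt_eq_zero, not_not]
      exact hg0
    obtain ⟨g', hg', hgg'⟩ := (natCast_le_analyticOrderAt hg).1 hord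
    refine ⟨g', hg', ?_⟩
    filter_upwards [hfg, hgg'] with t h h'
    rw [h, h', smul_smul, sub_zero, pow_one, pow_succ]

/-- A bound on a function says nothing about its derivative in general. Analyticity allows it, since
the factor `t ^ (k + 1)` can be split off and differentiated. -/
theorem AnalyticAt.deriv_isBigO_pow [CompleteSpace E] {f : ℝ → E} (hf : AnalyticAt ℝ f 0) {k : ℕ}
    (hO : f =O[𝓝 0] fun t : ℝ => t ^ (k + 1)) : deriv f =O[𝓝 0] fun t : ℝ => t ^ k := by
  obtain ⟨g, hg, hfg⟩ := hf.exists_eq_pow_smul_of_isBigO hO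
  have hd : ∀ᶠ t in 𝓝 (0 : ℝ), deriv f t = t ^ k • (t • deriv g t + ((k + 1 : ℕ) : ℝ) • g t) := by
    filter_upwards [hfg.eventually_nhds, hg.eventually_analyticAt] with t h h'
    rw [Filter.EventuallyEq.deriv_eq h]
    have := (hasDerivAt_pow (k + 1) t).fun_smul h'.differentiableAt.hasDerivAt
    rw [this.deriv]
    simp only [smul_add, smul_smul, pow_succ, Nat.add_sub_cancel]
    rw [mul_comm (t ^ k) ((k + 1 : ℕ) : ℝ)]
  refine Filter.EventuallyEq.trans_isBigO hd ?_
  have hcont : ContinuousAt (fun t : ℝ => t • deriv g t + ((k + 1 : ℕ) : ℝ) • g t) 0 := by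
    have h1 := hg.continuousAt
    have h2 := hg.deriv.continuousAt
    fun_prop
  simpa using (Asymptotics.isBigO_refl (fun t : ℝ => t ^ k) (𝓝 0)).smul
    (hcont.tendsto.isBigO_one ℝ)

/-- A polynomial of degree less than `p` that is `O(t ^ p)` vanishes. -/
theorem sum_pow_smul_eq_zero_of_isBigO (p : ℕ) (c : ℕ → E)
    (hO : (fun t : ℝ => ∑ k ∈ Finset.range p, t ^ k • c k) =O[𝓝[>] 0] fun t : ℝ => t ^ p) :
    ∀ k < p, c k = 0 := by
  induction p generalizing c with
  | zero => simp
  | succ p ih =>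
    have hc0 : c 0 = 0 := by
      have h1 : Filter.Tendsto (fun t : ℝ => ∑ k ∈ Finset.range (p + 1), t ^ k • c k) (𝓝[>] 0)
          (𝓝 (c 0)) := by
        have : Continuous fun t : ℝ => ∑ k ∈ Finset.range (p + 1), t ^ k • c k := by fun_prop
        have := (this.tendsto 0).mono_left (nhdsWithin_le_nhds (s := Set.Ioi 0))
        simpa [Finset.sum_range_succ'] using this
      have h2 : Filter.Tendsto (fun t : ℝ => t ^ (p + 1)) (𝓝[>] 0) (𝓝 0) := by
        simpa using ((continuous_pow (M := ℝ) (p + 1)).tendsto 0).mono_left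
          (nhdsWithin_le_nhds (s := Set.Ioi 0))
      exact tendsto_nhds_unique h1 (hO.trans_tendsto h2)
    have hrest := ih (fun k => c (k + 1)) (by
      obtain ⟨C, hC⟩ := hO.bound
      refine Asymptotics.IsBigO.of_bound C ?_
      filter_upwards [hC, self_mem_nhdsWithin] with t h ht
      have ht' : 0 < ‖t‖ := norm_pos_iff.2 (ne_of_gt ht)
      have hs : ∑ k ∈ Finset.range (p + 1), t ^ k • c k =
          t • ∑ k ∈ Finset.range p, t ^ k • c (k + 1) := by
        rw [Finset.sum_range_succ', hc0, smul_zero, add_zero, Finset.smul_sum]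
        exact Finset.sum_congr rfl fun k _ => by rw [smul_smul, pow_succ']
      rw [hs, norm_smul, pow_succ', norm_mul] at h
      have h' : ‖t‖ * ‖∑ k ∈ Finset.range p, t ^ k • c (k + 1)‖ ≤ ‖t‖ * (C * ‖t ^ p‖) := by
        linarith
      exact le_of_mul_le_mul_left h' ht')
    intro k hk
    cases k with
    | zero => exact hc0
    | succ k => exact hrest k (by omega)

end Factorization

/-! ### From the logarithmic derivative to the Trotter error -/

section TrotterError

variable {𝔸 : Type*} [CStarAlgebra 𝔸]

/-- Comparison of `exp (t K)` with a unitary solution of `S' = (K + T) S`. -/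
theorem norm_sub_exp_le_of_hasDerivAt {K : 𝔸} (hK : K ∈ skewAdjoint 𝔸) {S T : ℝ → 𝔸}
    (h0 : S 0 = 1) (hS : ∀ t, HasDerivAt S ((K + T t) * S t) t) (hU : ∀ t, S t ∈ unitary 𝔸)
    {c : ℝ} {p : ℕ} (hT : ∀ t, 0 ≤ t → ‖T t‖ ≤ c * t ^ p) {t : ℝ} (ht : 0 ≤ t) :
    ‖S t - NormedSpace.exp ((t : ℂ) • K)‖ ≤ c * (t ^ (p + 1) / (p + 1)) := by
  have hcomm : ∀ s : ℝ, NormedSpace.exp ((s : ℂ) • -K) * K = K * NormedSpace.exp ((s : ℂ) • -K) :=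
    fun s => ((((Commute.refl K).neg_right).smul_right (s : ℂ)).exp_right).eq.symm
  have hV : ∀ s : ℝ, NormedSpace.exp ((s : ℂ) • -K) ∈ unitary 𝔸 := fun s =>
    exp_ofReal_smul_mem_unitary (neg_mem hK) s
  -- Interaction picture: after removal of the exact evolution, the derivative is `T s` between two
  -- unitaries, so its norm is `‖T s‖`.
  have hderiv : ∀ s : ℝ, HasDerivAt (fun s : ℝ => NormedSpace.exp ((s : ℂ) • -K) * S s - 1)
      (NormedSpace.exp ((s : ℂ) • -K) * (T s * S s)) s := by
    intro s
    refine (((hasDerivAt_exp_ofReal_smul (-K) s).mul (hS s)).sub_const 1).congr_deriv ?_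
    have := hcomm s
    rw [add_mul, mul_add, ← mul_assoc _ K, this]
    noncomm_ring
  have hbound := image_norm_le_of_norm_deriv_right_le_deriv_boundary (a := 0) (b := t)
    (f := fun s : ℝ => NormedSpace.exp ((s : ℂ) • -K) * S s - 1)
    (B := fun s => c * (s ^ (p + 1) / (p + 1))) (B' := fun s => c * s ^ p)
    (fun s _ => (hderiv s).continuousAt.continuousWithinAt)
    (fun s _ => (hderiv s).hasDerivWithinAt) (by simp [h0]) (fun s => by
      refine (((hasDerivAt_pow (p + 1) s).div_const ((p : ℝ) + 1)).const_mul c).congr_deriv ?_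
      push_cast
      field_simp)
    (fun s hs => by
      rw [CStarRing.norm_mem_unitary_mul _ (hV s), CStarRing.norm_mul_mem_unitary _ (hU s)]
      exact hT s hs.1)
    (Set.right_mem_Icc.2 ht)
  refine le_trans (le_of_eq ?_) hbound
  rw [← CStarRing.norm_mem_unitary_mul _ (hV t), mul_sub]
  have : NormedSpace.exp ((t : ℂ) • -K) * NormedSpace.exp ((t : ℂ) • K) = 1 := by
    rw [← star_exp_ofReal_smul hK]
    exact Unitary.star_mul_self_of_mem (exp_ofReal_smul_mem_unitary hK t)
  rw [this]

/-- The case of a constant perturbation `A - B`, used to compare the truncated with the full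
evolution. -/
theorem norm_exp_sub_exp_le {A B : 𝔸} (hA : A ∈ skewAdjoint 𝔸) (hB : B ∈ skewAdjoint 𝔸) {t : ℝ}
    (ht : 0 ≤ t) :
    ‖NormedSpace.exp ((t : ℂ) • A) - NormedSpace.exp ((t : ℂ) • B)‖ ≤ ‖A - B‖ * t := by
  have := norm_sub_exp_le_of_hasDerivAt hB (S := fun t : ℝ => NormedSpace.exp ((t : ℂ) • A))
    (T := fun _ => A - B) (by simp) (fun s => by
      simpa using hasDerivAt_exp_ofReal_smul A s) (exp_ofReal_smul_mem_unitary hA)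
    (c := ‖A - B‖) (p := 0) (by simp) ht
  simpa using this

/-- The logarithmic derivative of `trotter L`. -/
noncomputable def trotterGen : List 𝔸 → ℝ → 𝔸
  | [], _ => 0
  | A :: L, t => trotterGen L t + trotter L t * A * star (trotter L t)

theorem hasDerivAt_trotter {L : List 𝔸} (hL : ∀ A ∈ L, A ∈ skewAdjoint 𝔸) (t : ℝ) :
    HasDerivAt (trotter L) (trotterGen L t * trotter L t) t := by
  induction L with
  | nil => simpa [trotter, trotterGen] using hasDerivAt_const t (1 : 𝔸)
  | cons A L ih =>
    have hL' := fun B hB => hL B (List.mem_cons_of_mem A hB)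
    refine ((ih hL').mul (hasDerivAt_exp_ofReal_smul A t)).congr_deriv ?_
    have hU : star (trotter L t) * trotter L t = 1 :=
      Unitary.star_mul_self_of_mem (trotter_mem_unitary hL' t)
    simp only [trotter, trotterGen, add_mul]
    rw [mul_assoc (trotter L t * A), ← mul_assoc (star _), hU]
    noncomm_ring

/-- Each factor is conjugated only by the factors after it in the list; enlarging the alphabet to
the whole list makes the bound uniform. The coefficients stay unspecified because the order
condition will determine them. -/
theorem exists_trotterGen_taylor {L : List 𝔸} (hL : ∀ A ∈ L, A ∈ skewAdjoint 𝔸) (p : ℕ) :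
    ∃ c : ℕ → 𝔸, ∀ τ : ℝ, 0 ≤ τ →
      ‖trotterGen L τ - ∑ k ∈ Finset.range p, τ ^ k • c k‖ ≤
        τ ^ p * (L.map (commSum L p)).sum := by
  induction L with
  | nil => exact ⟨0, by simp [trotterGen]⟩
  | cons A L ih =>
    have hL' := fun B hB => hL B (List.mem_cons_of_mem A hB)
    obtain ⟨c, hc⟩ := ih hL'
    obtain ⟨c', hc'⟩ := exists_conj_trotter_taylor hL' p A
    refine ⟨fun k => c k + c' k, fun τ hτ => ?_⟩
    have hsplit : trotterGen (A :: L) τ - ∑ k ∈ Finset.range p, τ ^ k • (c k + c' k) =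
        (trotterGen L τ - ∑ k ∈ Finset.range p, τ ^ k • c k) +
        (trotter L τ * A * star (trotter L τ) - ∑ k ∈ Finset.range p, τ ^ k • c' k) := by
      simp only [trotterGen, smul_add, Finset.sum_add_distrib]
      abel
    rw [hsplit]
    refine (norm_add_le _ _).trans ((add_le_add (hc τ hτ) (hc' τ hτ)).trans ?_)
    rw [← mul_add, List.map_cons, List.sum_cons, add_comm]
    gcongr
    · exact commSum_le_cons A L p A
    · exact List.sum_le_sum fun B _ => commSum_le_cons A L p B

theorem analyticAt_exp_ofReal_smul (A : 𝔸) (t : ℝ) :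
    AnalyticAt ℝ (fun t : ℝ => NormedSpace.exp ((t : ℂ) • A)) t := by
  simp only [Complex.coe_smul]
  have h1 : AnalyticAt ℝ (NormedSpace.exp : 𝔸 → 𝔸) (t • A) := NormedSpace.exp_analytic (𝕂 := ℝ) _
  exact h1.comp_of_eq (analyticAt_id.smul analyticAt_const) rfl

theorem analyticAt_trotter (L : List 𝔸) (t : ℝ) : AnalyticAt ℝ (trotter L) t := by
  induction L with
  | nil => exact analyticAt_const
  | cons A L ih => exact ih.mul (analyticAt_exp_ofReal_smul A t)

/-- **Trotter error with commutator scaling.** -/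
theorem norm_trotter_sub_exp_le {L : List 𝔸} (hL : ∀ A ∈ L, A ∈ skewAdjoint 𝔸) {K : 𝔸}
    (hK : K ∈ skewAdjoint 𝔸) {p : ℕ} (hp : 1 ≤ p)
    (hO : (fun t : ℝ => trotter L t - NormedSpace.exp ((t : ℂ) • K)) =O[𝓝 0]
      fun t : ℝ => t ^ (p + 1)) {t : ℝ} (ht : 0 ≤ t) :
    ‖trotter L t - NormedSpace.exp ((t : ℂ) • K)‖ ≤
      (L.map (commSum L p)).sum * t ^ (p + 1) := by
  have hU := trotter_mem_unitary hL
  set T : ℝ → 𝔸 := fun t => trotterGen L t - K with hTdef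
  have hderiv : ∀ t, HasDerivAt (trotter L) ((K + T t) * trotter L t) t := fun t =>
    (hasDerivAt_trotter hL t).congr_deriv (by simp [hTdef])
  -- With `D = S - exp (t K)` one has `T S = D' - K D`. Here `D = O(t ^ (p + 1))` and, by
  -- analyticity, `D' = O(t ^ p)`; the unitary `S` does not change norms.
  have hTO : T =O[𝓝 0] fun t : ℝ => t ^ p := by
    have hd := ((analyticAt_trotter L 0).fun_sub (analyticAt_exp_ofReal_smul K 0)).deriv_isBigO_pow hO
    have hpow : (fun t : ℝ => t ^ (p + 1)) =O[𝓝 0] fun t : ℝ => t ^ p :=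
      (Asymptotics.isLittleO_pow_pow (Nat.lt_succ_self p)).isBigO
    have h2 := hd.sub ((hO.trans hpow).const_mul_left K)
    have h3 : ∀ s, ‖T s‖ = ‖deriv (fun t : ℝ => trotter L t - NormedSpace.exp ((t : ℂ) • K)) s -
        K * (trotter L s - NormedSpace.exp ((s : ℂ) • K))‖ := by
      intro s
      rw [((hderiv s).fun_sub (hasDerivAt_exp_ofReal_smul K s)).deriv,
        ← CStarRing.norm_mul_mem_unitary _ (hU s)]
      congr 1
      noncomm_ring
    exact (Asymptotics.isBigO_of_le _ fun s => (h3 s).le).trans h2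
  obtain ⟨c, hc⟩ := exists_trotterGen_taylor hL p
  -- Since `p ≥ 1`, the polynomial has a constant coefficient into which `K` can be absorbed.
  obtain ⟨q, rfl⟩ : ∃ q, p = q + 1 := ⟨p - 1, by omega⟩
  set c' : ℕ → 𝔸 := fun k => c k - if k = 0 then K else 0 with hc'
  have hTc : ∀ τ : ℝ, T τ - ∑ k ∈ Finset.range (q + 1), τ ^ k • c' k =
      trotterGen L τ - ∑ k ∈ Finset.range (q + 1), τ ^ k • c k := by
    intro τ
    simp only [hTdef, hc', Finset.sum_range_succ', smul_sub, Nat.succ_ne_zero, if_false, smul_zero,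
      sub_zero, if_true, pow_zero, one_smul]
    abel
  set W := (L.map (commSum L (q + 1))).sum
  have hT1 : ∀ τ : ℝ, 0 ≤ τ → ‖T τ - ∑ k ∈ Finset.range (q + 1), τ ^ k • c' k‖ ≤
      W * τ ^ (q + 1) := fun τ hτ => by
    rw [hTc, mul_comm]; exact hc τ hτ
  -- `T` and its Taylor remainder are both `O(t ^ p)` from the right, hence so is the polynomial of
  -- degree less than `p`, which must vanish.
  have hzero : ∀ k < q + 1, c' k = 0 := by
    refine sum_pow_smul_eq_zero_of_isBigO _ _ ?_
    have h1 : (fun τ : ℝ => T τ - ∑ k ∈ Finset.range (q + 1), τ ^ k • c' k) =O[𝓝[>] 0]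
        fun t : ℝ => t ^ (q + 1) := by
      refine Asymptotics.IsBigO.of_bound W ?_
      filter_upwards [self_mem_nhdsWithin] with τ hτ
      have hτ' : (0 : ℝ) ≤ τ := le_of_lt hτ
      rw [Real.norm_of_nonneg (by positivity : 0 ≤ τ ^ (q + 1))]
      exact hT1 τ hτ'
    simpa using (hTO.mono nhdsWithin_le_nhds).sub h1
  have hT2 : ∀ τ : ℝ, 0 ≤ τ → ‖T τ‖ ≤ W * τ ^ (q + 1) := by
    intro τ hτ
    have := hT1 τ hτ
    rwa [Finset.sum_eq_zero fun k hk => by rw [hzero k (Finset.mem_range.1 hk), smul_zero],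
      sub_zero] at this
  refine (norm_sub_exp_le_of_hasDerivAt hK (trotter_zero L) hderiv hU hT2 ht).trans ?_
  have hW : 0 ≤ W := List.sum_nonneg (by
    simp only [List.mem_map]
    rintro _ ⟨A, -, rfl⟩
    exact commSum_nonneg _ _ _)
  gcongr
  exact div_le_self (by positivity) (by linarith [(Nat.cast_nonneg (q + 1) : (0 : ℝ) ≤ _)])

end TrotterError

/-! ### Supports and nested commutators of two-site operators -/

section Locality

variable {S : Type*} [Fintype S] [DecidableEq S]

open scoped Kronecker in
/-- The embedding `a ↦ a ⊗ 1` of the operators on the qubits in `X`. -/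
noncomputable def localEmbed (X : Finset S) : QubitOp X →ₐ[ℂ] QubitOp S :=
  AlgHom.ofLinearMap
    { toFun := fun a => (a ⊗ₖ (1 : Matrix ({k // k ∉ X} → Fin 2) ({k // k ∉ X} → Fin 2) ℂ)).submatrix
        (Equiv.piEquivPiSubtypeProd (· ∈ X) fun _ => Fin 2)
        (Equiv.piEquivPiSubtypeProd (· ∈ X) fun _ => Fin 2)
      map_add' := fun a b => by rw [Matrix.add_kronecker]; rfl
      map_smul' := fun c a => by rw [Matrix.smul_kronecker]; rfl }
    (by
      change Matrix.submatrix _ _ _ = _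
      rw [Matrix.one_kronecker_one, Matrix.submatrix_one_equiv])
    (fun a b => by
      change Matrix.submatrix _ _ _ = Matrix.submatrix _ _ _ * Matrix.submatrix _ _ _
      rw [Matrix.submatrix_mul_equiv, ← Matrix.mul_kronecker_mul, one_mul])

theorem localEmbed_apply (X : Finset S) (a : QubitOp X) (x y : S → Fin 2) :
    localEmbed X a x y =
      if ∀ k, k ∉ X → x k = y k then a (fun k => x k) (fun k => y k) else 0 := by
  change a (fun k => x k) (fun k => y k) *
    (1 : Matrix ({k // k ∉ X} → Fin 2) ({k // k ∉ X} → Fin 2) ℂ) (fun k => x k) (fun k => y k) = _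
  rw [Matrix.one_apply]
  simp only [funext_iff, Subtype.forall, mul_ite, mul_one, mul_zero]

/-- The operators supported on `X` form the range of an algebra homomorphism; closure under scalars,
commutators and exponentials follows. -/
theorem supportedOn_iff {X : Finset S} {A : QubitOp S} :
    SupportedOn X A ↔ A ∈ (localEmbed X).range := by
  constructor
  · rintro ⟨a, ha⟩
    refine ⟨a, ?_⟩
    ext x y
    change localEmbed X a x y = _
    rw [localEmbed_apply]
    split_ifs with h
    · exact ((ha x y).1 h).symm
    · exact ((ha x y).2 h).symm
  · rintro ⟨a, rfl⟩
    refine ⟨a, fun x y => ?_⟩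
    change (_ → localEmbed X a x y = _) ∧ (_ → localEmbed X a x y = _)
    rw [localEmbed_apply]
    exact ⟨fun h => if_pos h, fun h => if_neg h⟩

theorem SupportedOn.mono {X Y : Finset S} (hXY : X ⊆ Y) {A : QubitOp S} (hA : SupportedOn X A) :
    SupportedOn Y A := by
  obtain ⟨a, ha⟩ := hA
  refine ⟨Matrix.of fun u v => if ∀ k : Y, (k : S) ∉ X → u k = v k then
    a (fun k => u ⟨k, hXY k.2⟩) (fun k => v ⟨k, hXY k.2⟩) else 0, fun x y => ⟨fun h => ?_, fun h => ?_⟩⟩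
  · by_cases hX : ∀ k, k ∉ X → x k = y k
    · rw [(ha x y).1 hX, Matrix.of_apply]
      symm
      exact if_pos (Subtype.forall.2 fun k _ hk => hX k hk)
    · rw [(ha x y).2 hX, Matrix.of_apply, if_neg]
      exact fun hc => hX fun k hk => if hkY : k ∈ Y then hc ⟨k, hkY⟩ hk else h k hkY
  · exact (ha x y).2 fun hc => h fun k hk => hc k fun hkX => hk (hXY hkX)

theorem SupportedOn.smul {X : Finset S} {A : QubitOp S} (hA : SupportedOn X A) (c : ℂ) :
    SupportedOn X (c • A) := by
  rw [supportedOn_iff] at *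
  exact Subalgebra.smul_mem _ hA c

theorem SupportedOn.lie {X : Finset S} {A B : QubitOp S} (hA : SupportedOn X A)
    (hB : SupportedOn X B) : SupportedOn X ⁅A, B⁆ := by
  rw [supportedOn_iff] at *
  rw [Ring.lie_def]
  exact sub_mem (mul_mem hA hB) (mul_mem hB hA)

theorem SupportedOn.exp {X : Finset S} {A : QubitOp S} (hA : SupportedOn X A) :
    SupportedOn X (NormedSpace.exp A) := by
  rw [supportedOn_iff] at *
  obtain ⟨a, rfl⟩ := hA
  let : NormedAlgebra ℚ (QubitOp X) := .restrictScalars ℚ ℂ _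
  exact ⟨NormedSpace.exp a, NormedSpace.map_exp (localEmbed X)
    (localEmbed X).toLinearMap.continuous_of_finiteDimensional a⟩

/-- Only one intermediate configuration contributes to the matrix product: `A` can change `x` only
on `X`, and `B` cannot change it there, so it equals `y` on `X` and `x` elsewhere. -/
theorem SupportedOn.mul_apply {X Y : Finset S} (hXY : Disjoint X Y) {A B : QubitOp S}
    (hA : SupportedOn X A) (hB : SupportedOn Y B) (x y : S → Fin 2) :
    (A * B) x y = A x (X.piecewise y x) * B (X.piecewise y x) y := by
  obtain ⟨a, ha⟩ := hA
  obtain ⟨b, hb⟩ := hB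
  rw [Matrix.mul_apply]
  refine Finset.sum_eq_single _ (fun z _ hz => ?_) (by simp)
  by_cases h1 : ∀ k, k ∉ X → x k = z k
  · have h2 : ¬ ∀ k, k ∉ Y → z k = y k := by
      intro h2
      refine hz (funext fun k => ?_)
      by_cases hk : k ∈ X
      · rw [Finset.piecewise_eq_of_mem _ _ _ hk]
        exact h2 k (Finset.disjoint_left.1 hXY hk)
      · rw [Finset.piecewise_eq_of_notMem _ _ _ hk]
        exact (h1 k hk).symm
    rw [(hb z y).2 h2, mul_zero]
  · rw [(ha x z).2 h1, zero_mul]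

theorem SupportedOn.apply_congr {X : Finset S} {A : QubitOp S} (hA : SupportedOn X A)
    {x y x' y' : S → Fin 2} (hx : ∀ k ∈ X, x k = x' k) (hy : ∀ k ∈ X, y k = y' k)
    (h : (∀ k, k ∉ X → x k = y k) ↔ ∀ k, k ∉ X → x' k = y' k) : A x y = A x' y' := by
  obtain ⟨a, ha⟩ := hA
  by_cases hc : ∀ k, k ∉ X → x k = y k
  · rw [(ha x y).1 hc, (ha x' y').1 (h.1 hc)]
    congr 1
    · exact funext fun k => hx k k.2
    · exact funext fun k => hy k k.2
  · rw [(ha x y).2 hc, (ha x' y').2 (fun h' => hc (h.2 h'))]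

theorem SupportedOn.apply_eq_zero {X : Finset S} {A : QubitOp S} (hA : SupportedOn X A)
    {x y : S → Fin 2} {k : S} (hk : k ∉ X) (hxy : x k ≠ y k) : A x y = 0 := by
  obtain ⟨a, ha⟩ := hA
  exact (ha x y).2 fun h => hxy (h k hk)

/-- Both products reduce to one entry of `A` times one entry of `B`. These entries agree when `x =
y` off `X` and `Y`; otherwise both products vanish. -/
theorem SupportedOn.lie_eq_zero {X Y : Finset S} (hXY : Disjoint X Y) {A B : QubitOp S}
    (hA : SupportedOn X A) (hB : SupportedOn Y B) : ⁅A, B⁆ = 0 := by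
  rw [Ring.lie_def, sub_eq_zero]
  ext x y
  rw [hA.mul_apply hXY hB, hB.mul_apply hXY.symm hA, mul_comm]
  have hd : ∀ k ∈ X, k ∉ Y := fun k hk => Finset.disjoint_left.1 hXY hk
  have hd' : ∀ k ∈ Y, k ∉ X := fun k hk => Finset.disjoint_right.1 hXY hk
  by_cases hc : ∀ k, k ∉ X → k ∉ Y → x k = y k
  · congr 1
    · refine hB.apply_congr (fun k hk => ?_) (fun k hk => ?_) (iff_of_true (fun k hk => ?_)
        (fun k hk => ?_))
      · rw [Finset.piecewise_eq_of_notMem _ _ _ (hd' k hk)]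
      · rw [Finset.piecewise_eq_of_mem _ _ _ hk]
      · by_cases hkX : k ∈ X
        · rw [Finset.piecewise_eq_of_mem _ _ _ hkX]
        · rw [Finset.piecewise_eq_of_notMem _ _ _ hkX, hc k hkX hk]
      · rw [Finset.piecewise_eq_of_notMem _ _ _ hk]
    · refine hA.apply_congr (fun k hk => ?_) (fun k hk => ?_) (iff_of_true (fun k hk => ?_)
        (fun k hk => ?_))
      · rw [Finset.piecewise_eq_of_notMem _ _ _ (hd k hk)]
      · rw [Finset.piecewise_eq_of_mem _ _ _ hk]
      · rw [Finset.piecewise_eq_of_notMem _ _ _ hk]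
      · by_cases hkY : k ∈ Y
        · rw [Finset.piecewise_eq_of_mem _ _ _ hkY]
        · rw [Finset.piecewise_eq_of_notMem _ _ _ hkY, hc k hk hkY]
  · push Not at hc
    obtain ⟨k, hkX, hkY, hk⟩ := hc
    rw [hB.apply_eq_zero hkY (x := X.piecewise y x), hA.apply_eq_zero hkX (x := Y.piecewise y x),
      zero_mul, mul_zero]
    · rwa [Finset.piecewise_eq_of_notMem _ _ _ hkY]
    · rwa [Finset.piecewise_eq_of_notMem _ _ _ hkX]

/-- The constant in the bound of sums of nested commutators of two-site operators. -/
noncomputable def commConst : ℕ → ℕ → ℝ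
  | 0, _ => 1
  | p + 1, m => 2 * m * commConst p (m + 2)

theorem commConst_nonneg (p m : ℕ) : 0 ≤ commConst p m := by
  induction p generalizing m with
  | zero => exact zero_le_one
  | succ p ih => exact mul_nonneg (by positivity) (ih _)

theorem list_sum_finset_sum_comm {ι κ : Type*} (L : List ι) (s : Finset κ) (f : ι → κ → ℝ) :
    (L.map fun q => ∑ i ∈ s, f q i).sum = ∑ i ∈ s, (L.map fun q => f q i).sum := by
  induction L with
  | nil => simp
  | cons q L ih => simp [ih, Finset.sum_add_distrib]

theorem norm_lie_le {𝔸 : Type*} [NormedRing 𝔸] (A B : 𝔸) : ‖⁅A, B⁆‖ ≤ 2 * ‖A‖ * ‖B‖ := by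
  rw [Ring.lie_def]
  have h1 := norm_mul_le A B
  have h2 := norm_mul_le B A
  linarith [norm_sub_le (A * B) (B * A), mul_comm ‖A‖ ‖B‖]

/-- Nested commutators of two-site operators, when every site carries interactions of total
strength at most `h`. -/
theorem commSum_le_of_supportedOn {ι : Type*} (L : List ι) (A : ι → QubitOp S)
    (X : ι → Finset S) (hA : ∀ q ∈ L, SupportedOn (X q) (A q)) (hX : ∀ q ∈ L, (X q).card ≤ 2)
    {h : ℝ} (hh : ∀ i, (L.map fun q => if i ∈ X q then ‖A q‖ else 0).sum ≤ h) (hh0 : 0 ≤ h)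
    (p m : ℕ) (Y : Finset S) (hY : Y.card ≤ m) (B : QubitOp S) (hB : SupportedOn Y B) :
    commSum (L.map A) p B ≤ commConst p m * h ^ p * ‖B‖ := by
  induction p generalizing m Y B with
  | zero => simp [commSum, commConst]
  | succ p ih =>
    simp only [commSum, List.map_map, Function.comp_def]
    set D := commConst p (m + 2) * h ^ p with hD
    have hD0 : 0 ≤ D := mul_nonneg (commConst_nonneg _ _) (pow_nonneg hh0 _)
    -- A summand disjoint from `Y` contributes nothing. Any other one is charged to a site of `Y`
    -- that it touches; this is where `m * h` comes from.
    have hterm : ∀ q ∈ L, commSum (L.map A) p ⁅A q, B⁆ ≤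
        (∑ i ∈ Y, if i ∈ X q then ‖A q‖ else 0) * (2 * D * ‖B‖) := by
      intro q hq
      by_cases hd : Disjoint (X q) Y
      · rw [(hA q hq).lie_eq_zero hd hB, commSum_zero]
        refine mul_nonneg (Finset.sum_nonneg fun i _ => ?_) (by positivity)
        split_ifs <;> positivity
      · obtain ⟨i, hiX, hiY⟩ := Finset.not_disjoint_iff.1 hd
        have h1 : ‖A q‖ ≤ ∑ i ∈ Y, if i ∈ X q then ‖A q‖ else 0 := by
          refine le_trans (by rw [if_pos hiX]) (Finset.single_le_sum
            (f := fun i => if i ∈ X q then ‖A q‖ else 0) (fun i _ => ?_) hiY)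
          split_ifs <;> positivity
        -- Each commutator enlarges the support by at most two sites, which explains `m + 2` in
        -- `commConst`; its factor `2` is that of `norm_lie_le`.
        have h2 := ih (m + 2) (X q ∪ Y)
          ((Finset.card_union_le _ _).trans (by linarith [hX q hq])) ⁅A q, B⁆
          (((hA q hq).mono Finset.subset_union_left).lie (hB.mono Finset.subset_union_right))
        calc _ ≤ D * ‖⁅A q, B⁆‖ := h2
          _ ≤ D * (2 * ‖A q‖ * ‖B‖) := by gcongr; exact norm_lie_le _ _
          _ = ‖A q‖ * (2 * D * ‖B‖) := by ring
          _ ≤ _ := by gcongr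
    calc _ ≤ (L.map fun q => (∑ i ∈ Y, if i ∈ X q then ‖A q‖ else 0) * (2 * D * ‖B‖)).sum :=
          List.sum_le_sum hterm
      _ = (∑ i ∈ Y, (L.map fun q => if i ∈ X q then ‖A q‖ else 0).sum) * (2 * D * ‖B‖) := by
          rw [List.sum_map_mul_right, list_sum_finset_sum_comm]
      _ ≤ (m * h) * (2 * D * ‖B‖) := by
          gcongr
          calc _ ≤ ∑ i ∈ Y, h := Finset.sum_le_sum fun i _ => hh i
            _ = Y.card * h := by simp
            _ ≤ m * h := by gcongr
      _ = _ := by rw [hD, commConst, pow_succ]; ring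

/-- The innermost operator is itself a summand and is charged to one site of its support. Summing
over sites yields the factor `Fintype.card S` and the last power of `h`. -/
theorem sum_commSum_le_of_supportedOn {ι : Type*} (L : List ι) (A : ι → QubitOp S)
    (X : ι → Finset S) (hA : ∀ q ∈ L, SupportedOn (X q) (A q)) (hX : ∀ q ∈ L, (X q).card ≤ 2)
    (hne : ∀ q ∈ L, (X q).Nonempty) {h : ℝ}
    (hh : ∀ i, (L.map fun q => if i ∈ X q then ‖A q‖ else 0).sum ≤ h) (hh0 : 0 ≤ h) (p : ℕ) :
    ((L.map A).map (commSum (L.map A) p)).sum ≤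
      commConst p 2 * (Fintype.card S * h ^ (p + 1)) := by
  have hc := commConst_nonneg p 2
  rw [List.map_map]
  calc _ ≤ (L.map fun q => (∑ i, if i ∈ X q then ‖A q‖ else 0) * (commConst p 2 * h ^ p)).sum := by
        refine List.sum_le_sum fun q hq => ?_
        obtain ⟨i, hi⟩ := hne q hq
        have h1 : ‖A q‖ ≤ ∑ i, if i ∈ X q then ‖A q‖ else 0 := by
          refine le_trans (by rw [if_pos hi]) (Finset.single_le_sum
            (f := fun i => if i ∈ X q then ‖A q‖ else 0) (fun i _ => ?_) (Finset.mem_univ i))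
          split_ifs <;> positivity
        refine (commSum_le_of_supportedOn L A X hA hX hh hh0 p 2 (X q) (hX q hq) (A q)
          (hA q hq)).trans ?_
        rw [mul_comm]
        gcongr
    _ = (∑ i, (L.map fun q => if i ∈ X q then ‖A q‖ else 0).sum) * (commConst p 2 * h ^ p) := by
        rw [List.sum_map_mul_right, list_sum_finset_sum_comm]
    _ ≤ (∑ _i : S, h) * (commConst p 2 * h ^ p) := by
        gcongr with i
        exact hh i
    _ = _ := by simp [pow_succ]; ring

end Locality

/-! ### Trotter error of product formulas -/

namespace ProductFormula

variable {Υ : ℕ} {ι : Type*} [Fintype ι] {S : Type*} [Fintype S] [DecidableEq S]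

/-- The positions of the factors of a product formula, in the order of their application. -/
def positions (Υ : ℕ) (N : ℕ) : List (Fin Υ × Fin N) :=
  (List.finRange Υ).flatMap fun υ => (List.finRange N).map fun γ => (υ, γ)

/-- The exponent at a position of a product formula. -/
noncomputable def term (F : ProductFormula Υ ι) (K : ι → QubitOp S)
    (x : Fin Υ × Fin (Fintype.card ι)) : QubitOp S :=
  (F.coeff x.1 x.2 : ℂ) • K (F.order x.1 x.2)

theorem _root_.trotter_map_eq_prod {𝔸 : Type*} [CStarAlgebra 𝔸] {κ : Type*} (L : List κ)
    (f : κ → 𝔸) (t : ℝ) :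
    trotter (L.map f) t = (L.map fun x => NormedSpace.exp ((t : ℂ) • f x)).reverse.prod := by
  induction L with
  | nil => rfl
  | cons x L ih => simp [trotter, ih]

theorem _root_.trotter_flatMap_eq_prod {𝔸 : Type*} [CStarAlgebra 𝔸] {κ : Type*} (L : List κ)
    (f : κ → List 𝔸) (t : ℝ) :
    trotter (L.flatMap f) t = (L.map fun x => trotter (f x) t).reverse.prod := by
  induction L with
  | nil => rfl
  | cons x L ih => simp [trotter_append, ih]

theorem eval_eq_trotter (F : ProductFormula Υ ι) (K : ι → QubitOp S) (t : ℝ) :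
    F.eval K t = trotter ((positions Υ (Fintype.card ι)).map (F.term K)) t := by
  rw [positions, List.map_flatMap, trotter_flatMap_eq_prod]
  simp only [eval, List.ofFn_eq_map, List.map_map, Function.comp_def, trotter_map_eq_prod, term,
    smul_smul, Complex.ofReal_mul]

theorem sum_map_positions (N : ℕ) (f : Fin Υ × Fin N → ℝ) :
    ((positions Υ N).map f).sum = ∑ υ, ∑ γ, f (υ, γ) := by
  simp only [positions, List.map_flatMap, List.map_map, Function.comp_def, Fin.sum_univ_def]
  induction List.finRange Υ with
  | nil => rfl
  | cons a L ih => simp [ih]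

theorem norm_term_le (F : ProductFormula Υ ι) (K : ι → QubitOp S)
    (x : Fin Υ × Fin (Fintype.card ι)) : ‖F.term K x‖ ≤ ‖K (F.order x.1 x.2)‖ := by
  rw [term, norm_smul, Complex.norm_real]
  exact mul_le_of_le_one_left (norm_nonneg _) (F.coeff_le _ _)

/-- Every stage is a permutation of the summands, so a formula multiplies the strength at a site by
at most `Υ`. -/
theorem sum_positions_le (F : ProductFormula Υ ι) (g : ι → ℝ) :
    ((positions Υ (Fintype.card ι)).map fun x => g (F.order x.1 x.2)).sum = Υ * ∑ q, g q := by
  rw [sum_map_positions]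
  simp only [Equiv.sum_comp (F.order _) g, Finset.sum_const, Finset.card_univ, Fintype.card_fin,
    nsmul_eq_mul]

theorem term_mem_skewAdjoint (F : ProductFormula Υ ι) {K : ι → QubitOp S}
    (hK : ∀ q, K q ∈ skewAdjoint (QubitOp S)) :
    ∀ A ∈ (positions Υ (Fintype.card ι)).map (F.term K), A ∈ skewAdjoint (QubitOp S) := by
  simp only [List.mem_map]
  rintro _ ⟨x, -, rfl⟩
  exact ofReal_smul_mem_skewAdjoint (hK _) _

theorem eval_mem_unitary (F : ProductFormula Υ ι) {K : ι → QubitOp S}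
    (hK : ∀ q, K q ∈ skewAdjoint (QubitOp S)) (t : ℝ) : F.eval K t ∈ unitary (QubitOp S) := by
  rw [eval_eq_trotter]
  exact trotter_mem_unitary (F.term_mem_skewAdjoint hK) t

theorem HasOrder.norm_sub_le {F : ProductFormula Υ ι} {p : ℕ} {K : ι → QubitOp S}
    (hF : F.HasOrder p K) (hp : 1 ≤ p) (hK : ∀ q, K q ∈ skewAdjoint (QubitOp S)) {t : ℝ}
    (ht : 0 ≤ t) :
    ‖F.eval K t - NormedSpace.exp ((t : ℂ) • ∑ q, K q)‖ ≤
      (((positions Υ (Fintype.card ι)).map (F.term K)).map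
        (commSum ((positions Υ (Fintype.card ι)).map (F.term K)) p)).sum * t ^ (p + 1) := by
  unfold HasOrder at hF
  simp only [eval_eq_trotter] at hF ⊢
  exact norm_trotter_sub_exp_le (F.term_mem_skewAdjoint hK) (sum_mem fun q _ => hK q) hp hF ht

/-- Trotter error for two-site summands of total strength at most `h` at every site. -/
theorem HasOrder.norm_sub_le_of_supportedOn {F : ProductFormula Υ ι} {p : ℕ} {K : ι → QubitOp S}
    (hF : F.HasOrder p K) (hp : 1 ≤ p) (hK : ∀ q, K q ∈ skewAdjoint (QubitOp S))
    (X : ι → Finset S) (hKX : ∀ q, SupportedOn (X q) (K q)) (hX : ∀ q, (X q).card ≤ 2)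
    (hne : ∀ q, (X q).Nonempty) {h : ℝ} (hh : ∀ i, ∑ q, (if i ∈ X q then ‖K q‖ else 0) ≤ h)
    (hh0 : 0 ≤ h) {t : ℝ} (ht : 0 ≤ t) :
    ‖F.eval K t - NormedSpace.exp ((t : ℂ) • ∑ q, K q)‖ ≤
      commConst p 2 * (Fintype.card S * (Υ * h) ^ (p + 1)) * t ^ (p + 1) := by
  refine (hF.norm_sub_le hp hK ht).trans ?_
  gcongr
  refine sum_commSum_le_of_supportedOn _ (F.term K) (fun x => X (F.order x.1 x.2))
    (fun x _ => (hKX _).smul _) (fun x _ => hX _) (fun x _ => hne _) (fun i => ?_)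
    (by positivity) p
  calc _ ≤ ((positions Υ (Fintype.card ι)).map fun x =>
        (fun q => if i ∈ X q then ‖K q‖ else 0) (F.order x.1 x.2)).sum := by
        refine List.sum_le_sum fun x _ => ?_
        dsimp only
        split_ifs
        · exact F.norm_term_le K x
        · exact le_rfl
    _ = Υ * ∑ q, (if i ∈ X q then ‖K q‖ else 0) :=
        F.sum_positions_le fun q => if i ∈ X q then ‖K q‖ else 0
    _ ≤ Υ * h := by gcongr; exact hh i

/-- A product formula of positive order is exact if there is only one summand. -/
theorem HasOrder.eval_eq_of_subsingleton [Subsingleton ι] {F : ProductFormula Υ ι} {p : ℕ}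
    {K : ι → QubitOp S} (hF : F.HasOrder p K) (hp : 1 ≤ p)
    (hK : ∀ q, K q ∈ skewAdjoint (QubitOp S)) {t : ℝ} (ht : 0 ≤ t) :
    F.eval K t = NormedSpace.exp ((t : ℂ) • ∑ q, K q) := by
  have h := hF.norm_sub_le hp hK ht
  obtain ⟨q, rfl⟩ : ∃ q, p = q + 1 := ⟨p - 1, by omega⟩
  have hlie : ∀ x y, ⁅F.term K x, F.term K y⁆ = 0 := by
    intro x y
    rw [term, term, Subsingleton.elim (F.order x.1 x.2) (F.order y.1 y.2), Ring.lie_def,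
      sub_eq_zero]
    exact (((Commute.refl _).smul_left _).smul_right _).eq
  simp only [List.map_map, Function.comp_def, commSum, hlie, commSum_zero, List.map_const',
    List.sum_replicate, smul_zero, zero_mul] at h
  exact sub_eq_zero.1 (norm_le_zero_iff.1 h)

end ProductFormula

/-! ### Power sums and summation by rank -/

section PowerSums

/-- Comparison with `∫ x ^ (-s)` over `[a, b]`. The requirement `1 ≤ a` keeps the singularity at `0`
away, so sums from the first term treat that term separately. -/
theorem sum_Ico_rpow_neg_le {s : ℝ} (hs0 : 0 ≤ s) (hs1 : s ≠ 1) {a b : ℕ} (ha : 1 ≤ a)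
    (hab : a ≤ b) :
    ∑ k ∈ Finset.Ico a b, ((k + 1 : ℕ) : ℝ) ^ (-s) ≤
      ((b : ℝ) ^ (1 - s) - (a : ℝ) ^ (1 - s)) / (1 - s) := by
  have ha' : (0 : ℝ) < a := by exact_mod_cast ha
  have hab' : (a : ℝ) ≤ b := by exact_mod_cast hab
  refine (AntitoneOn.sum_le_integral_Ico (f := fun x : ℝ => x ^ (-s)) hab ?_).trans ?_
  · intro x hx y hy hxy
    exact Real.rpow_le_rpow_of_nonpos (ha'.trans_le hx.1) hxy (by linarith)
  · rw [integral_rpow, neg_add_eq_sub]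
    refine Or.inr ⟨fun h => hs1 (by linarith), ?_⟩
    rw [Set.uIcc_of_le hab']
    exact fun h => absurd h.1 (not_le.2 ha')

theorem sum_range_rpow_neg_le_of_lt_one {s : ℝ} (hs0 : 0 ≤ s) (hs1 : s < 1) {N : ℕ} (hN : 1 ≤ N) :
    ∑ k ∈ Finset.range N, ((k + 1 : ℕ) : ℝ) ^ (-s) ≤ (N : ℝ) ^ (1 - s) / (1 - s) := by
  have h := sum_Ico_rpow_neg_le hs0 hs1.ne le_rfl hN
  have hpos : 0 < 1 - s := by linarith
  have h1 : 1 ≤ 1 / (1 - s) := by rw [le_div_iff₀ hpos]; linarith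
  rw [Finset.range_eq_Ico, Finset.sum_eq_sum_Ico_succ_bot hN]
  simp only [zero_add, Nat.cast_one, Real.one_rpow, sub_div] at h ⊢
  linarith

theorem sum_range_rpow_neg_le_of_one_lt {s : ℝ} (hs1 : 1 < s) (N : ℕ) :
    ∑ k ∈ Finset.range N, ((k + 1 : ℕ) : ℝ) ^ (-s) ≤ s / (s - 1) := by
  have hpos : 0 < s - 1 := by linarith
  rcases Nat.eq_zero_or_pos N with rfl | hN
  · simp only [Finset.range_zero, Finset.sum_empty]
    positivity
  have h := sum_Ico_rpow_neg_le (by linarith) hs1.ne' le_rfl hN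
  rw [Finset.range_eq_Ico, Finset.sum_eq_sum_Ico_succ_bot hN]
  simp only [zero_add, Nat.cast_one, Real.one_rpow] at h ⊢
  have hb : ((N : ℝ) ^ (1 - s) - 1) / (1 - s) = (1 - (N : ℝ) ^ (1 - s)) / (s - 1) := by
    rw [← neg_sub, ← neg_sub s 1, neg_div_neg_eq]
  have h2 : (1 - (N : ℝ) ^ (1 - s)) / (s - 1) ≤ 1 / (s - 1) := by
    gcongr
    linarith [Real.rpow_nonneg (Nat.cast_nonneg (α := ℝ) N) (1 - s)]
  have h3 : s / (s - 1) = 1 + 1 / (s - 1) := by field_simp; ring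
  linarith

theorem sum_Ico_rpow_neg_le_of_one_lt {s : ℝ} (hs1 : 1 < s) {a b : ℕ} (ha : 1 ≤ a) (hab : a ≤ b) :
    ∑ k ∈ Finset.Ico a b, ((k + 1 : ℕ) : ℝ) ^ (-s) ≤ (a : ℝ) ^ (1 - s) / (s - 1) := by
  have hpos : 0 < s - 1 := by linarith
  refine (sum_Ico_rpow_neg_le (by linarith) hs1.ne' ha hab).trans ?_
  have hswap : ∀ x y : ℝ, (x - y) / (1 - s) = (y - x) / (s - 1) := fun x y => by
    rw [← neg_sub y x, ← neg_sub s 1, neg_div_neg_eq]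
  rw [hswap]
  gcongr
  linarith [Real.rpow_nonneg (Nat.cast_nonneg (α := ℝ) b) (1 - s)]

theorem sum_range_inv_le (N : ℕ) :
    ∑ k ∈ Finset.range N, ((k + 1 : ℕ) : ℝ) ^ (-1 : ℝ) ≤ 1 + Real.log N := by
  have h := harmonic_le_one_add_log N
  simp only [harmonic, Rat.cast_sum, Rat.cast_inv, Rat.cast_natCast] at h
  simpa only [Real.rpow_neg_one] using h

/-- A sum over `T` is bounded by a sum over ranks if every nonempty subset `U` of `T` contains an
element whose value is at most `G (card U)`. -/
theorem sum_le_sum_rank {β : Type*} [DecidableEq β] (f : β → ℝ) (G : ℕ → ℝ) (T : Finset β)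
    (h : ∀ U ⊆ T, U.Nonempty → ∃ u ∈ U, f u ≤ G U.card) :
    ∑ j ∈ T, f j ≤ ∑ k ∈ Finset.range T.card, G (k + 1) := by
  induction hn : T.card generalizing T with
  | zero => simp [Finset.card_eq_zero.1 hn]
  | succ n ih =>
    -- The element supplied for `T` itself takes the last rank; the hypothesis passes to what
    -- remains after its removal.
    obtain ⟨u, hu, hfu⟩ := h T subset_rfl (Finset.card_pos.1 (by omega))
    rw [Finset.sum_range_succ, ← Finset.sum_erase_add _ _ hu]
    refine add_le_add (ih _ (fun U hU => h U (hU.trans (Finset.erase_subset _ _))) ?_) ?_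
    · rw [Finset.card_erase_of_mem hu, hn, Nat.add_sub_cancel]
    · rwa [← hn]

end PowerSums

/-! ### Lattice sums of inverse powers of the distance -/

section Lattice

variable {d : ℕ}

theorem siteDist_comm (i j : Fin d → ℤ) : siteDist i j = siteDist j i := by
  unfold siteDist
  congr 1
  exact Finset.sum_congr rfl fun k _ => by ring

theorem siteDist_self (i : Fin d → ℤ) : siteDist i i = 0 := by simp [siteDist]

theorem abs_sub_le_siteDist (i j : Fin d → ℤ) (k : Fin d) :
    |(i k : ℝ) - j k| ≤ siteDist i j := by
  rw [← Real.sqrt_sq_eq_abs]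
  exact Real.sqrt_le_sqrt (Finset.single_le_sum
    (f := fun k => ((i k : ℝ) - j k) ^ 2) (fun k _ => sq_nonneg _) (Finset.mem_univ k))

theorem one_le_siteDist {i j : Fin d → ℤ} (hij : i ≠ j) : 1 ≤ siteDist i j := by
  obtain ⟨k, hk⟩ := Function.ne_iff.1 hij
  refine le_trans ?_ (abs_sub_le_siteDist i j k)
  have := Int.one_le_abs (sub_ne_zero.2 hk)
  exact_mod_cast this

theorem card_le_of_siteDist_le (i : Fin d → ℤ) (U : Finset (Fin d → ℤ)) {R : ℝ} (hR : 0 ≤ R)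
    (hU : ∀ j ∈ U, siteDist i j ≤ R) : (U.card : ℝ) ≤ (2 * R + 1) ^ d := by
  have hsub : U ⊆ Finset.Icc (fun k => i k - ⌊R⌋) (fun k => i k + ⌊R⌋) := by
    intro j hj
    have h : ∀ k, |i k - j k| ≤ ⌊R⌋ := fun k => by
      rw [Int.le_floor]
      push_cast
      exact (abs_sub_le_siteDist i j k).trans (hU j hj)
    rw [Finset.mem_Icc, Pi.le_def, Pi.le_def]
    exact ⟨fun k => by linarith [(abs_le.1 (h k)).2], fun k => by linarith [(abs_le.1 (h k)).1]⟩
  have hfl : 0 ≤ ⌊R⌋ := Int.floor_nonneg.2 hR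
  calc (U.card : ℝ) ≤ (Finset.Icc (fun k => i k - ⌊R⌋) (fun k => i k + ⌊R⌋)).card := by
        exact_mod_cast Finset.card_le_card hsub
    _ = (2 * (⌊R⌋ : ℝ) + 1) ^ d := by
        rw [Pi.card_Icc]
        simp only [Int.card_Icc]
        push_cast
        rw [Finset.prod_congr rfl (g := fun _ => 2 * (⌊R⌋ : ℝ) + 1), Finset.prod_const]
        · simp
        · intro k _
          have : ((i k + ⌊R⌋ + 1 - (i k - ⌊R⌋)).toNat : ℤ) = 2 * ⌊R⌋ + 1 := by
            rw [Int.toNat_of_nonneg (by omega)]; ring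
          exact_mod_cast this
    _ ≤ (2 * R + 1) ^ d := by
        have := Int.floor_le R
        have : (0 : ℝ) ≤ ⌊R⌋ := by exact_mod_cast hfl
        gcongr

/-- Among `card U` sites other than `i`, one is at distance at least `(card U) ^ (1 / d) / 3`
from `i`. -/
theorem exists_inv_siteDist_rpow_le (hd : 0 < d) {α : ℝ} (hα : 0 ≤ α) {i : Fin d → ℤ}
    {U : Finset (Fin d → ℤ)} (hi : i ∉ U) (hU : U.Nonempty) :
    ∃ u ∈ U, 1 / siteDist i u ^ α ≤ 3 ^ α * (U.card : ℝ) ^ (-(α / d)) := by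
  -- With `R` the distance from `i` to the farthest point, all of `U` lies in a ball of radius `R ≥
  -- 1`, so `card U ≤ (2 R + 1) ^ d ≤ (3 R) ^ d`.
  obtain ⟨u, hu, hmax⟩ := U.exists_max_image (siteDist i) hU
  refine ⟨u, hu, ?_⟩
  have h1 : 1 ≤ siteDist i u := one_le_siteDist fun h => hi (h ▸ hu)
  have hcard : (U.card : ℝ) ≤ (3 * siteDist i u) ^ d :=
    (card_le_of_siteDist_le i U (by linarith) hmax).trans (by gcongr; linarith)
  have hpos : (0 : ℝ) < U.card := by exact_mod_cast hU.card_pos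
  have hd' : (d : ℝ) ≠ 0 := by exact_mod_cast hd.ne'
  have h2 : (U.card : ℝ) ^ (α / d) ≤ (3 * siteDist i u) ^ α := by
    calc (U.card : ℝ) ^ (α / d) ≤ ((3 * siteDist i u) ^ d) ^ (α / d) := by gcongr
      _ = (3 * siteDist i u) ^ α := by
        rw [← Real.rpow_natCast, ← Real.rpow_mul (by linarith)]
        congr 1
        field_simp
  rw [Real.mul_rpow (by norm_num) (by linarith)] at h2
  have h3 : 0 < siteDist i u ^ α := Real.rpow_pos_of_pos (by linarith) _
  have h4 : 0 < (U.card : ℝ) ^ (α / d) := Real.rpow_pos_of_pos hpos _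
  rw [Real.rpow_neg hpos.le, ← div_eq_mul_inv, div_le_div_iff₀ h3 h4]
  linarith

/-- Ranking by distance replaces the lattice sum by a one-dimensional power sum of exponent `α / d`,
whatever the shape of the set of sites. -/
theorem sum_inv_siteDist_le (hd : 0 < d) {α : ℝ} (hα : 0 ≤ α) (i : Fin d → ℤ)
    (T : Finset (Fin d → ℤ)) (hi : i ∉ T) :
    ∑ j ∈ T, 1 / siteDist i j ^ α ≤
      3 ^ α * ∑ k ∈ Finset.range T.card, ((k + 1 : ℕ) : ℝ) ^ (-(α / d)) := by
  rw [Finset.mul_sum]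
  exact sum_le_sum_rank _ (fun k => 3 ^ α * (k : ℝ) ^ (-(α / d))) T fun U hU hne =>
    exists_inv_siteDist_rpow_le hd hα (fun h => hi (hU h)) hne

/-- Scaling of the total interaction strength at a site. -/
noncomputable def rowRate (d : ℕ) (α : ℝ) (n : ℕ) : ℝ :=
  if α < d then (n : ℝ) ^ (1 - α / d) else if α = d then Real.log n else 1

theorem rowRate_nonneg (d : ℕ) (α : ℝ) (n : ℕ) : 0 ≤ rowRate d α n := by
  unfold rowRate
  have := Real.log_natCast_nonneg n
  split_ifs <;> positivity

/-- The regimes are `α / d` below, at and above `1`. The summand `1` stands for the on-site term; at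
`α = d` it can be absorbed in `log n` only if there are at least two sites. -/
theorem exists_row_sum_le (hd : 0 < d) {α : ℝ} (hα : 0 ≤ α) :
    ∃ C : ℝ, 0 < C ∧ ∀ Λ : Finset (Fin d → ℤ), 2 ≤ Λ.card → ∀ i ∈ Λ,
      1 + ∑ j ∈ Λ.erase i, 1 / siteDist i j ^ α ≤ C * rowRate d α Λ.card := by
  have hd' : (0 : ℝ) < d := by exact_mod_cast hd
  have h3 : (0 : ℝ) < 3 ^ α := by positivity
  have key : ∀ Λ : Finset (Fin d → ℤ), ∀ i ∈ Λ,
      ∑ j ∈ Λ.erase i, 1 / siteDist i j ^ α ≤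
        3 ^ α * ∑ k ∈ Finset.range Λ.card, ((k + 1 : ℕ) : ℝ) ^ (-(α / d)) := by
    intro Λ i hi
    refine (sum_inv_siteDist_le hd hα i _ (Finset.notMem_erase i Λ)).trans ?_
    gcongr
    · exact Finset.erase_subset _ _
  have hs0 : 0 ≤ α / d := by positivity
  rcases lt_trichotomy α d with h | h | h
  · have hs1 : α / d < 1 := by rwa [div_lt_one hd']
    have hpos : 0 < 1 - α / d := by linarith
    refine ⟨1 + 3 ^ α / (1 - α / d), by positivity, fun Λ hΛ i hi => ?_⟩
    rw [rowRate, if_pos h]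
    have h1 := key Λ i hi
    have h2 := sum_range_rpow_neg_le_of_lt_one hs0 hs1 (N := Λ.card) (by omega)
    have h4 : 1 ≤ (Λ.card : ℝ) ^ (1 - α / d) :=
      Real.one_le_rpow (by exact_mod_cast (by omega : 1 ≤ Λ.card)) hpos.le
    calc _ ≤ (Λ.card : ℝ) ^ (1 - α / d) + 3 ^ α * ((Λ.card : ℝ) ^ (1 - α / d) / (1 - α / d)) := by
          refine add_le_add h4 (h1.trans ?_)
          gcongr
      _ = _ := by ring
  · have hs1 : α / d = 1 := by rw [h, div_self hd'.ne']
    have hlog2 : 0 < Real.log 2 := Real.log_pos (by norm_num)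
    refine ⟨(1 + 3 ^ α) / Real.log 2 + 3 ^ α, by positivity, fun Λ hΛ i hi => ?_⟩
    rw [rowRate, if_neg h.not_lt, if_pos h]
    have h1 := key Λ i hi
    rw [hs1] at h1
    have h2 := sum_range_inv_le Λ.card
    have h4 : Real.log 2 ≤ Real.log Λ.card :=
      Real.log_le_log (by norm_num) (by exact_mod_cast hΛ)
    have h5 : 1 + 3 ^ α ≤ (1 + 3 ^ α) / Real.log 2 * Real.log Λ.card := by
      rw [div_mul_eq_mul_div, le_div_iff₀ hlog2]
      gcongr
    have h6 := mul_le_mul_of_nonneg_left h2 h3.le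
    linarith
  · have hs1 : 1 < α / d := by rwa [one_lt_div hd']
    have hpos : 0 < α / d - 1 := by linarith
    refine ⟨1 + 3 ^ α * (α / d / (α / d - 1)), by positivity, fun Λ hΛ i hi => ?_⟩
    rw [rowRate, if_neg h.not_gt, if_neg h.ne', mul_one]
    have h6 := mul_le_mul_of_nonneg_left (sum_range_rpow_neg_le_of_one_lt hs1 Λ.card) h3.le
    linarith [key Λ i hi]

-- About `ℓ ^ d` ranks are estimated by the cutoff, each term being at most `ℓ ^ (-α)`, and the
-- later ranks by the density of the lattice. Both parts are of size `ℓ ^ (d - α)`. For `ℓ < 1` the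
-- whole lattice sum is bounded and `ℓ ^ (d - α) ≥ 1`.
open Classical in
theorem exists_tail_sum_le (hd : 0 < d) {α : ℝ} (hα : (d : ℝ) < α) :
    ∃ C : ℝ, 0 < C ∧ ∀ (Λ : Finset (Fin d → ℤ)) (i : Fin d → ℤ) (ℓ : ℝ), 0 < ℓ →
      ∑ j ∈ Λ with ℓ < siteDist i j, 1 / siteDist i j ^ α ≤ C * ℓ ^ ((d : ℝ) - α) := by
  have hd' : (0 : ℝ) < d := by exact_mod_cast hd
  have hα0 : 0 ≤ α := hd'.le.trans hα.le
  have h3 : (0 : ℝ) < 3 ^ α := by positivity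
  have hs1 : 1 < α / d := by rwa [one_lt_div hd']
  have hpos : 0 < α / d - 1 := by linarith
  refine ⟨2 + 3 ^ α * (α / d / (α / d - 1)) + 3 ^ α / (α / d - 1), by positivity,
    fun Λ i ℓ hℓ => ?_⟩
  set T := Λ.filter fun j => ℓ < siteDist i j with hT
  have hiT : i ∉ T := by
    rw [hT, Finset.mem_filter, siteDist_self]
    exact fun h => absurd h.2 (not_lt.2 hℓ.le)
  have hpw : 0 < ℓ ^ ((d : ℝ) - α) := by positivity
  have hA : 0 < 3 ^ α * (α / d / (α / d - 1)) := by positivity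
  have hB : 0 < 3 ^ α / (α / d - 1) := by positivity
  rcases lt_or_ge ℓ 1 with hℓ1 | hℓ1
  · have h1 : 1 ≤ ℓ ^ ((d : ℝ) - α) :=
      Real.one_le_rpow_of_pos_of_le_one_of_nonpos hℓ hℓ1.le (by linarith)
    have h2 := sum_inv_siteDist_le hd hα0 i T hiT
    have h6 := mul_le_mul_of_nonneg_left (sum_range_rpow_neg_le_of_one_lt hs1 T.card) h3.le
    nlinarith
  · set M := ⌈ℓ ^ d⌉₊ with hM
    have hℓd : 1 ≤ ℓ ^ d := one_le_pow₀ hℓ1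
    have hMl : ℓ ^ d ≤ M := Nat.le_ceil _
    have hM1 : 1 ≤ M := by exact_mod_cast hℓd.trans hMl
    have hMu : (M : ℝ) ≤ 2 * ℓ ^ d := by
      have := Nat.ceil_lt_add_one (zero_le_one.trans hℓd)
      linarith
    set G : ℕ → ℝ := fun k => if k ≤ M then 1 / ℓ ^ α else 3 ^ α * (k : ℝ) ^ (-(α / d)) with hG
    have hG0 : ∀ k, 0 ≤ G k := fun k => by
      simp only [hG]
      split_ifs <;> positivity
    have hrank := sum_le_sum_rank (fun j => 1 / siteDist i j ^ α) G T fun U hU hne => by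
      by_cases hc : U.card ≤ M
      · obtain ⟨u, hu⟩ := hne
        refine ⟨u, hu, ?_⟩
        have : ℓ < siteDist i u := (Finset.mem_filter.1 (hU hu)).2
        simp only [hG, if_pos hc]
        gcongr
      · obtain ⟨u, hu, h⟩ := exists_inv_siteDist_rpow_le hd hα0 (fun h => hiT (hU h)) hne
        exact ⟨u, hu, by simpa only [hG, if_neg hc] using h⟩
    -- The sum over ranks is extended so that it can be split at `M` even if `T` has fewer than `M`
    -- elements.
    have hNmax : M ≤ max T.card M := le_max_right _ _
    have hpow1 : ℓ ^ d * (1 / ℓ ^ α) = ℓ ^ ((d : ℝ) - α) := by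
      rw [Real.rpow_sub hℓ, Real.rpow_natCast]; ring
    have hpow2 : (M : ℝ) ^ (1 - α / d) ≤ ℓ ^ ((d : ℝ) - α) := by
      calc (M : ℝ) ^ (1 - α / d) ≤ (ℓ ^ d) ^ (1 - α / d) :=
            Real.rpow_le_rpow_of_nonpos (by positivity) hMl (by linarith)
        _ = ℓ ^ ((d : ℝ) - α) := by
            rw [← Real.rpow_natCast, ← Real.rpow_mul hℓ.le]
            congr 1
            field_simp
    calc _ ≤ ∑ k ∈ Finset.range T.card, G (k + 1) := hrank
      _ ≤ ∑ k ∈ Finset.range (max T.card M), G (k + 1) := by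
          refine Finset.sum_le_sum_of_subset_of_nonneg ?_ fun k _ _ => hG0 _
          exact Finset.range_subset_range.2 (le_max_left _ _)
      _ = ∑ k ∈ Finset.range M, G (k + 1) + ∑ k ∈ Finset.Ico M (max T.card M), G (k + 1) :=
          (Finset.sum_range_add_sum_Ico _ hNmax).symm
      _ = M * (1 / ℓ ^ α) +
            3 ^ α * ∑ k ∈ Finset.Ico M (max T.card M), ((k + 1 : ℕ) : ℝ) ^ (-(α / d)) := by
          congr 1
          · rw [Finset.sum_congr rfl (g := fun _ => 1 / ℓ ^ α)]
            · simp
            · intro k hk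
              exact if_pos (Finset.mem_range.1 hk)
          · rw [Finset.mul_sum]
            refine Finset.sum_congr rfl fun k hk => if_neg ?_
            have := (Finset.mem_Ico.1 hk).1
            omega
      _ ≤ 2 * ℓ ^ d * (1 / ℓ ^ α) + 3 ^ α * (ℓ ^ ((d : ℝ) - α) / (α / d - 1)) := by
          gcongr
          exact (sum_Ico_rpow_neg_le_of_one_lt hs1 hM1 hNmax).trans (by gcongr)
      _ = (2 + 3 ^ α / (α / d - 1)) * ℓ ^ ((d : ℝ) - α) := by
          rw [mul_assoc, hpow1]; ring
      _ ≤ _ := by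
          gcongr
          linarith

end Lattice

/-! ### Real-time evolution and accumulation of the error over steps -/

section Evolution

variable {S ι : Type*} [Fintype S] [DecidableEq S]

theorem norm_generators (H : ι → QubitOp S) (q : ι) : ‖generators H q‖ = ‖H q‖ := by
  simp [generators, norm_smul]

theorem generators_mem_skewAdjoint {H : ι → QubitOp S} (hH : ∀ q, (H q).IsHermitian) (q : ι) :
    generators H q ∈ skewAdjoint (QubitOp S) := by
  rw [skewAdjoint.mem_iff, generators, star_smul]
  have : star (H q) = H q := hH q
  rw [this]
  simp

theorem evolution_eq [Fintype ι] (H : ι → QubitOp S) (t : ℝ) :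
    evolution H t = NormedSpace.exp ((t : ℂ) • ∑ q, generators H q) := by
  simp only [evolution, generators, ← Finset.smul_sum, smul_smul]
  congr 2
  ring

theorem evolution_mem_unitary [Fintype ι] {H : ι → QubitOp S} (hH : ∀ q, (H q).IsHermitian)
    (t : ℝ) : evolution H t ∈ unitary (QubitOp S) := by
  rw [evolution_eq]
  exact exp_ofReal_smul_mem_unitary (sum_mem fun q _ => generators_mem_skewAdjoint hH q) t

theorem evolution_div_pow [Fintype ι] (H : ι → QubitOp S) (t : ℝ) {r : ℕ} (hr : 0 < r) :
    evolution H (t / r) ^ r = evolution H t := by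
  let : NormedAlgebra ℚ (QubitOp S) := .restrictScalars ℚ ℂ _
  have hr' : (r : ℂ) ≠ 0 := by exact_mod_cast hr.ne'
  rw [evolution, ← NormedSpace.exp_nsmul, evolution]
  congr 1
  rw [← Nat.cast_smul_eq_nsmul ℂ, smul_smul]
  congr 1
  push_cast
  field_simp

/-- Telescoping: for contractions, the errors of the steps add up without amplification. -/
theorem norm_pow_sub_pow_le {𝔸 : Type*} [NormedRing 𝔸] [NormOneClass 𝔸] {a b : 𝔸} (ha : ‖a‖ ≤ 1)
    (hb : ‖b‖ ≤ 1) (r : ℕ) : ‖a ^ r - b ^ r‖ ≤ r * ‖a - b‖ := by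
  induction r with
  | zero => simp
  | succ r ih =>
    have h : a ^ (r + 1) - b ^ (r + 1) = a ^ r * (a - b) + (a ^ r - b ^ r) * b := by
      rw [pow_succ, pow_succ]; noncomm_ring
    have har : ‖a ^ r‖ ≤ 1 := (norm_pow_le a r).trans (pow_le_one₀ (norm_nonneg _) ha)
    rw [h]
    calc _ ≤ ‖a ^ r‖ * ‖a - b‖ + ‖a ^ r - b ^ r‖ * ‖b‖ :=
          (norm_add_le _ _).trans (add_le_add (norm_mul_le _ _) (norm_mul_le _ _))
      _ ≤ 1 * ‖a - b‖ + (r * ‖a - b‖) * 1 := by gcongr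
      _ = _ := by push_cast; ring

theorem norm_eval_pow_sub_evolution_le {Υ : ℕ} [Fintype ι] (F : ProductFormula Υ ι)
    {H : ι → QubitOp S} (hH : ∀ q, (H q).IsHermitian) (t : ℝ) {r : ℕ} (hr : 0 < r) :
    ‖F.eval (generators H) (t / r) ^ r - evolution H t‖ ≤
      r * ‖F.eval (generators H) (t / r) - evolution H (t / r)‖ := by
  rw [← evolution_div_pow H t hr]
  exact norm_pow_sub_pow_le
    (CStarRing.norm_of_mem_unitary (F.eval_mem_unitary (generators_mem_skewAdjoint hH) _)).le
    (CStarRing.norm_of_mem_unitary (evolution_mem_unitary hH _)).le r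

end Evolution

/-- If the error of one step is `C X s ^ (p + 1)`, then `(C X t ^ (p + 1) / ε) ^ (1 / p)` steps are
enough for the total error `ε`. -/
theorem mul_step_error_le {C X t ε : ℝ} {p r : ℕ} (hp : 1 ≤ p) (hC : 0 < C) (hX : 0 ≤ X)
    (ht : 0 ≤ t) (hε : 0 < ε) (hr : 0 < r)
    (h : C ^ (1 / (p : ℝ)) * (X * t ^ (p + 1) / ε) ^ (1 / (p : ℝ)) ≤ r) :
    r * (C * (X * (t / r) ^ (p + 1))) ≤ ε := by
  have hr' : (0 : ℝ) < r := by exact_mod_cast hr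
  rw [← Real.mul_rpow hC.le (by positivity)] at h
  have h2 : C * (X * t ^ (p + 1) / ε) ≤ (r : ℝ) ^ p := by
    have h3 := pow_le_pow_left₀ (by positivity) h p
    rwa [one_div, Real.rpow_inv_natCast_pow (by positivity) (by omega)] at h3
  have h4 : C * (X * t ^ (p + 1)) ≤ (r : ℝ) ^ p * ε := by
    rwa [← mul_div_assoc, div_le_iff₀ hε] at h2
  have h5 : r * (C * (X * (t / r) ^ (p + 1))) = C * (X * t ^ (p + 1)) / (r : ℝ) ^ p := by
    rw [div_pow, pow_succ (r : ℝ) p]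
    field_simp
  rw [h5, div_le_iff₀ (by positivity)]
  linarith

/-! ### The three regimes in one formula -/

section Rates

theorem errorRate_eq (d : ℕ) (α : ℝ) (p : ℕ) {n : ℕ} (hn : 0 < n) (t : ℝ) :
    errorRate d α p n t = n * rowRate d α n ^ (p + 1) * t ^ (p + 1) := by
  have hn' : (0 : ℝ) < n := by exact_mod_cast hn
  unfold errorRate rowRate
  split_ifs
  · rw [Real.rpow_add hn', Real.rpow_one, mul_comm ((p : ℝ) + 1), ← Nat.cast_add_one,
      Real.rpow_mul_natCast hn'.le]
  · rfl
  · simp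

/-- The Trotter number is the `p`-th root of the one-step error over `ε`, evaluated at full time;
this is the form that `mul_step_error_le` needs. -/
theorem stepRate_eq (d : ℕ) (α : ℝ) {p n : ℕ} (hp : 1 ≤ p) (hn : 0 < n) {t ε : ℝ} (ht : 0 ≤ t)
    (hε : 0 < ε) :
    stepRate d α p n t ε =
      ((n * rowRate d α n ^ (p + 1)) * t ^ (p + 1) / ε) ^ (1 / (p : ℝ)) := by
  have hn' : (0 : ℝ) < n := by exact_mod_cast hn
  have hp' : (0 : ℝ) < p := by exact_mod_cast hp
  have hrow := rowRate_nonneg d α n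
  have hpow : ∀ x : ℝ, 0 ≤ x → (x ^ (p + 1)) ^ (1 / (p : ℝ)) = x ^ (1 + 1 / (p : ℝ)) := by
    intro x hx
    rw [← Real.rpow_natCast, ← Real.rpow_mul hx]
    congr 1
    push_cast
    field_simp
  rw [Real.div_rpow (by positivity) hε.le, Real.mul_rpow (by positivity) (by positivity),
    Real.mul_rpow hn'.le (by positivity), hpow t ht, hpow _ hrow]
  unfold stepRate rowRate
  split_ifs
  · rw [← Real.rpow_mul hn'.le, ← Real.rpow_add hn']
    congr 3
    field_simp
    ring
  · rfl
  · simp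

end Rates

/-! ### Trotter and truncation errors for power-law Hamiltonians -/

section PowerLaw

variable {d : ℕ} {α : ℝ}

theorem IsPowerLaw.norm_le {Λ : Finset (Fin d → ℤ)} {H : Λ × Λ → QubitOp Λ}
    (hH : IsPowerLaw α Λ H) (i : Λ) :
    (∑ j, ‖H (i, j)‖ ≤ 1 + ∑ j ∈ Λ.erase i, 1 / siteDist (i : Fin d → ℤ) j ^ α) ∧
    ∑ j, ‖H (j, i)‖ ≤ 1 + ∑ j ∈ Λ.erase i, 1 / siteDist (i : Fin d → ℤ) j ^ α := by
  have hsum : ∑ j ∈ Finset.univ.erase i, 1 / siteDist (i : Fin d → ℤ) j ^ α =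
      ∑ j ∈ Λ.erase i, 1 / siteDist (i : Fin d → ℤ) j ^ α := by
    refine Finset.sum_bij (fun j _ => (j : Fin d → ℤ)) ?_ ?_ ?_ ?_
    · intro j hj
      rw [Finset.mem_erase] at hj ⊢
      exact ⟨fun h => hj.1 (Subtype.ext h), j.2⟩
    · exact fun j _ k _ h => Subtype.ext h
    · intro j hj
      have hj' := Finset.mem_erase.1 hj
      exact ⟨⟨j, hj'.2⟩, Finset.mem_erase.2
        ⟨fun h => hj'.1 (congrArg Subtype.val h), Finset.mem_univ _⟩, rfl⟩
    · exact fun _ _ => rfl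
  rw [← hsum]
  constructor
  · rw [← Finset.add_sum_erase _ _ (Finset.mem_univ i)]
    exact add_le_add (hH.norm_diag i) (Finset.sum_le_sum fun j hj =>
      hH.norm_offdiag i j (Finset.ne_of_mem_erase hj).symm)
  · rw [← Finset.add_sum_erase _ _ (Finset.mem_univ i)]
    refine add_le_add (hH.norm_diag i) (Finset.sum_le_sum fun j hj => ?_)
    rw [siteDist_comm]
    exact hH.norm_offdiag j i (Finset.ne_of_mem_erase hj)

/-- A site occurs as first or as second member of a pair, hence the factor `2`. The injection `e`
serves the full family (`id`) and the truncated one (`Subtype.val`) at once. -/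
theorem IsPowerLaw.site_sum_le {Λ : Finset (Fin d → ℤ)} {H : Λ × Λ → QubitOp Λ}
    (hH : IsPowerLaw α Λ H) {ι : Type*} [Fintype ι] {e : ι → Λ × Λ} (he : Function.Injective e)
    (i : Λ) :
    ∑ q, (if i ∈ ({(e q).1, (e q).2} : Finset Λ) then ‖generators (fun q => H (e q)) q‖ else 0) ≤
      2 * (1 + ∑ j ∈ Λ.erase i, 1 / siteDist (i : Fin d → ℤ) j ^ α) := by
  simp only [norm_generators]
  have h1 : ∑ q, (if i ∈ ({(e q).1, (e q).2} : Finset Λ) then ‖H (e q)‖ else 0) ≤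
      ∑ q : Λ × Λ, (if i ∈ ({q.1, q.2} : Finset Λ) then ‖H q‖ else 0) := by
    classical
    rw [← Finset.sum_image (s := Finset.univ) (g := e)
      (f := fun q : Λ × Λ => if i ∈ ({q.1, q.2} : Finset Λ) then ‖H q‖ else 0) he.injOn]
    refine Finset.sum_le_sum_of_subset_of_nonneg (Finset.subset_univ _) fun q _ _ => ?_
    split_ifs <;> positivity
  have h2 : ∀ q : Λ × Λ, (if i ∈ ({q.1, q.2} : Finset Λ) then ‖H q‖ else 0) ≤
      (if q.1 = i then ‖H (i, q.2)‖ else 0) + (if q.2 = i then ‖H (q.1, i)‖ else 0) := by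
    rintro ⟨a, b⟩
    by_cases ha : a = i
    · subst ha
      simp only [Finset.mem_insert, true_or, if_true]
      have : 0 ≤ if b = a then ‖H (a, a)‖ else 0 := by split_ifs <;> positivity
      linarith
    · by_cases hb : b = i
      · subst hb
        simp [ha]
      · simp [ha, hb, eq_comm (a := i)]
  have h3 : ∑ q : Λ × Λ, ((if q.1 = i then ‖H (i, q.2)‖ else 0) +
      (if q.2 = i then ‖H (q.1, i)‖ else 0)) = ∑ j, ‖H (i, j)‖ + ∑ j, ‖H (j, i)‖ := by
    rw [Finset.sum_add_distrib]
    congr 1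
    · rw [Fintype.sum_prod_type]
      simp
    · rw [Fintype.sum_prod_type_right]
      simp
  have h4 := hH.norm_le i
  linarith [h1.trans (Finset.sum_le_sum fun q _ => h2 q)]

/-- Trotter error for a subfamily of the terms of a power-law Hamiltonian. -/
theorem exists_error_bound (hd : 0 < d) (hα : 0 ≤ α) {p : ℕ} (hp : 1 ≤ p) (Υ : ℕ) :
    ∃ C : ℝ, 0 < C ∧ ∀ Λ : Finset (Fin d → ℤ), Λ.Nonempty →
      ∀ H : Λ × Λ → QubitOp Λ, IsPowerLaw α Λ H →
      ∀ (ι : Type) [Fintype ι] (e : ι → Λ × Λ), Function.Injective e →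
      ∀ F : ProductFormula Υ ι, F.HasOrder p (generators fun q => H (e q)) →
      ∀ t : ℝ, 0 ≤ t →
        ‖F.eval (generators fun q => H (e q)) t - evolution (fun q => H (e q)) t‖ ≤
          C * ((Λ.card * rowRate d α Λ.card ^ (p + 1)) * t ^ (p + 1)) := by
  obtain ⟨C, hC, hrow⟩ := exists_row_sum_le hd hα
  have hc := commConst_nonneg p 2
  -- The summand `1` only makes the constant positive, for instance if `Υ = 0`.
  refine ⟨commConst p 2 * (Υ * (2 * C)) ^ (p + 1) + 1, by positivity,
    fun Λ hΛ H hH ι _ e he F hF t ht => ?_⟩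
  have hr := rowRate_nonneg d α Λ.card
  have hskew := generators_mem_skewAdjoint (H := fun q => H (e q)) fun q => hH.hermitian (e q)
  rw [evolution_eq]
  -- A single site must be treated apart: for `α = d` the claimed bound is then `0`, since `log 1 =
  -- 0`, and it holds because the formula is exact.
  rcases (Nat.succ_le_of_lt hΛ.card_pos).eq_or_lt with h1 | h1
  · have : Subsingleton Λ := by
      rw [← Finite.card_le_one_iff_subsingleton, Nat.card_eq_fintype_card, Fintype.card_coe]
      exact h1.ge
    have : Subsingleton ι := he.subsingleton
    rw [hF.eval_eq_of_subsingleton hp hskew ht, sub_self, norm_zero]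
    positivity
  · have hsite : ∀ i, ∑ q, (if i ∈ ({(e q).1, (e q).2} : Finset Λ) then
        ‖generators (fun q => H (e q)) q‖ else 0) ≤ 2 * (C * rowRate d α Λ.card) := fun i =>
      (hH.site_sum_le he i).trans (by linarith [hrow Λ h1 i i.2])
    refine (hF.norm_sub_le_of_supportedOn hp hskew (fun q => {(e q).1, (e q).2})
      (fun q => (hH.supported (e q)).smul _) (fun q => Finset.card_le_two)
      (fun q => Finset.insert_nonempty _ _) hsite (by positivity) ht).trans ?_
    rw [Fintype.card_coe]
    have : 0 ≤ (Λ.card * rowRate d α Λ.card ^ (p + 1)) * t ^ (p + 1) := by positivity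
    calc _ = commConst p 2 * (Υ * (2 * C)) ^ (p + 1) *
          ((Λ.card * rowRate d α Λ.card ^ (p + 1)) * t ^ (p + 1)) := by
          simp only [mul_pow]; ring
      _ ≤ _ := by linarith

/-- Trotter number for a subfamily of the terms of a power-law Hamiltonian. -/
theorem exists_step_bound (hd : 0 < d) (hα : 0 ≤ α) {p : ℕ} (hp : 1 ≤ p) (Υ : ℕ) :
    ∃ C : ℝ, 0 < C ∧ ∀ Λ : Finset (Fin d → ℤ), Λ.Nonempty →
      ∀ H : Λ × Λ → QubitOp Λ, IsPowerLaw α Λ H →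
      ∀ (ι : Type) [Fintype ι] (e : ι → Λ × Λ), Function.Injective e →
      ∀ F : ProductFormula Υ ι, F.HasOrder p (generators fun q => H (e q)) →
      ∀ t ε : ℝ, 0 ≤ t → 0 < ε → ∀ r : ℕ, 0 < r → C * stepRate d α p Λ.card t ε ≤ r →
        ‖F.eval (generators fun q => H (e q)) (t / r) ^ r - evolution (fun q => H (e q)) t‖ ≤ ε := by
  obtain ⟨C, hC, hbound⟩ := exists_error_bound hd hα hp Υ
  refine ⟨C ^ (1 / (p : ℝ)), by positivity,
    fun Λ hΛ H hH ι _ e he F hF t ε ht hε r hr hstep => ?_⟩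
  have hrow := rowRate_nonneg d α Λ.card
  rw [stepRate_eq d α hp hΛ.card_pos ht hε] at hstep
  refine (norm_eval_pow_sub_evolution_le F (fun q => hH.hermitian (e q)) t hr).trans
    (le_trans ?_ (mul_step_error_le hp hC (by positivity) ht hε hr hstep))
  gcongr
  exact hbound Λ hΛ H hH ι e he F hF _ (by positivity)

-- The discarded pairs are grouped by their first site, and each of the `n` sites contributes a tail
-- of the lattice sum.
open Classical in
theorem exists_norm_truncation_le (hd : 0 < d) (hα : (d : ℝ) < α) :
    ∃ C : ℝ, 0 < C ∧ ∀ Λ : Finset (Fin d → ℤ), ∀ H : Λ × Λ → QubitOp Λ, IsPowerLaw α Λ H →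
      ∀ ℓ : ℝ, 0 < ℓ →
        ‖∑ q, generators (truncate H ℓ) q - ∑ q, generators H q‖ ≤
          C * (Λ.card * ℓ ^ ((d : ℝ) - α)) := by
  obtain ⟨C, hC, htail⟩ := exists_tail_sum_le hd hα
  refine ⟨C, hC, fun Λ H hH ℓ hℓ => ?_⟩
  have h1 : ∑ q, generators (truncate H ℓ) q = ∑ q ∈ nearPairs Λ ℓ, generators H q :=
    Finset.sum_coe_sort (nearPairs Λ ℓ) (generators H)
  have h2 : ∑ q, generators H q = ∑ q ∈ nearPairs Λ ℓ, generators H q +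
      ∑ q : Λ × Λ with ¬ siteDist (q.1 : Fin d → ℤ) q.2 ≤ ℓ, generators H q :=
    (Finset.sum_filter_add_sum_filter_not _ _ _).symm
  rw [h1, h2, sub_add_cancel_left, norm_neg]
  refine (norm_sum_le _ _).trans ?_
  simp only [norm_generators]
  rw [Finset.sum_filter, Fintype.sum_prod_type]
  calc _ ≤ ∑ i : Λ, C * ℓ ^ ((d : ℝ) - α) := Finset.sum_le_sum fun i _ => ?_
    _ = _ := by simp; ring
  refine le_trans ?_ (htail Λ i ℓ hℓ)
  rw [Finset.sum_filter, ← Finset.sum_coe_sort Λ]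
  refine Finset.sum_le_sum fun j _ => ?_
  simp only [not_le]
  split_ifs with h
  · refine hH.norm_offdiag i j fun hij => ?_
    rw [hij, siteDist_self] at h
    exact absurd h (not_lt.2 hℓ.le)
  · exact le_rfl

/-- Range of the cutoff that guarantees a truncation error of at most `ε / 2`. -/
theorem exists_cutoff (hd : 0 < d) (hα : (d : ℝ) < α) :
    ∃ c₀ : ℝ, 0 < c₀ ∧ ∀ Λ : Finset (Fin d → ℤ), Λ.Nonempty →
      ∀ H : Λ × Λ → QubitOp Λ, IsPowerLaw α Λ H → ∀ t ε : ℝ, 0 ≤ t → 0 < ε →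
      ∀ ℓ : ℝ, c₀ * ((Λ.card : ℝ) * t / ε) ^ (1 / (α - d)) ≤ ℓ →
        ‖evolution (truncate H ℓ) t - evolution H t‖ ≤ ε / 2 := by
  obtain ⟨C, hC, htrunc⟩ := exists_norm_truncation_le hd hα
  have hαd : 0 < α - d := by linarith
  -- This value solves `C n t ℓ ^ (d - α) = ε / 2` for `ℓ`.
  refine ⟨(2 * C) ^ (1 / (α - d)), by positivity, fun Λ hΛ H hH t ε ht hε ℓ hℓ => ?_⟩
  have hn : (0 : ℝ) < Λ.card := by exact_mod_cast hΛ.card_pos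
  rw [evolution_eq, evolution_eq]
  -- For `t = 0` the cutoff may be `0`, where the tail bound is not available; both evolutions are
  -- then the identity.
  rcases ht.eq_or_lt with rfl | ht
  · simp only [Complex.ofReal_zero, zero_smul, sub_self, norm_zero]
    positivity
  rw [← Real.mul_rpow (by positivity) (by positivity)] at hℓ
  have hℓ0 : 0 < ℓ := lt_of_lt_of_le (by positivity) hℓ
  have h1 : 2 * C * (Λ.card * t / ε) ≤ ℓ ^ (α - d) := by
    have := Real.rpow_le_rpow (by positivity) hℓ hαd.le
    rwa [one_div, Real.rpow_inv_rpow (by positivity) hαd.ne'] at this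
  have hskew : ∀ q, generators H q ∈ skewAdjoint (QubitOp Λ) :=
    generators_mem_skewAdjoint hH.hermitian
  have h2 := norm_exp_sub_exp_le (A := ∑ q, generators (truncate H ℓ) q)
    (B := ∑ q, generators H q) (sum_mem fun q _ => hskew q) (sum_mem fun q _ => hskew q) ht.le
  refine h2.trans ((mul_le_mul_of_nonneg_right (htrunc Λ H hH ℓ hℓ0) ht.le).trans ?_)
  rw [← neg_sub, Real.rpow_neg hℓ0.le]
  have hpw : 0 < ℓ ^ (α - d) := by positivity
  have h3 : 2 * C * (Λ.card * t) ≤ ℓ ^ (α - d) * ε := by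
    rwa [← mul_div_assoc, div_le_iff₀ hε] at h1
  calc _ = C * (Λ.card * t) / ℓ ^ (α - d) := by ring
    _ ≤ ε / 2 := by
      rw [div_le_iff₀ hpw]
      linarith

/-- Trotter number for simulation with the truncated Hamiltonian. -/
theorem exists_truncated_step_bound (hd : 0 < d) (hα : (d : ℝ) < α) :
    ∃ c₀ : ℝ, 0 < c₀ ∧ ∀ p : ℕ, 1 ≤ p → ∀ Υ : ℕ, ∃ C : ℝ, 0 < C ∧
      ∀ (Λ : Finset (Fin d → ℤ)), Λ.Nonempty →
      ∀ H : Λ × Λ → QubitOp Λ, IsPowerLaw α Λ H →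
      ∀ t ε : ℝ, 0 ≤ t → 0 < ε →
      ∀ ℓ : ℝ, c₀ * ((Λ.card : ℝ) * t / ε) ^ (1 / (α - d)) ≤ ℓ →
      ∀ F : ProductFormula Υ (nearPairs Λ ℓ), F.HasOrder p (generators (truncate H ℓ)) →
      ∀ r : ℕ, 0 < r →
        C * ((Λ.card : ℝ) ^ (1 / (p : ℝ)) * t ^ (1 + 1 / (p : ℝ)) / ε ^ (1 / (p : ℝ))) ≤ r →
        ‖F.eval (generators (truncate H ℓ)) (t / r) ^ r - evolution H t‖ ≤ ε := by
  obtain ⟨c₀, hc₀, hcut⟩ := exists_cutoff hd hα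
  refine ⟨c₀, hc₀, fun p hp Υ => ?_⟩
  obtain ⟨C, hC, hstep⟩ := exists_step_bound (α := α) hd
    ((Nat.cast_nonneg d).trans hα.le) hp Υ
  -- Half of `ε` is spent on truncation, half on the product formula; the latter costs `2 ^ (1 / p)`
  -- in the number of steps.
  refine ⟨C * 2 ^ (1 / (p : ℝ)), by positivity, fun Λ hΛ H hH t ε ht hε ℓ hℓ F hF r hr h => ?_⟩
  have h1 := hstep Λ hΛ H hH (nearPairs Λ ℓ) Subtype.val Subtype.val_injective F hF t (ε / 2) ht
    (by positivity) r hr (by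
      refine le_of_eq_of_le ?_ h
      rw [stepRate, if_neg hα.not_gt, if_neg hα.ne', Real.div_rpow hε.le (by norm_num)]
      have : (0 : ℝ) < 2 ^ (1 / (p : ℝ)) := by positivity
      field_simp)
  have h2 := hcut Λ hΛ H hH t ε ht hε ℓ hℓ
  calc _ ≤ ε / 2 + ε / 2 := norm_sub_le_norm_sub_add_norm_sub _ _ _ |>.trans (add_le_add h1 h2)
    _ = ε := add_halves ε

end PowerLaw

/-! ### Circuits and gate counts -/

section Gates

variable {S : Type*} [Fintype S] [DecidableEq S]

theorem Implements.pow {c : List (QubitOp S)} {U : QubitOp S} (h : Implements c U) (r : ℕ) :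
    ∃ c' : List (QubitOp S), Implements c' (U ^ r) ∧ c'.length = r * c.length := by
  refine ⟨(List.replicate r c).flatten, ⟨fun g hg => ?_, ?_⟩, by simp⟩
  · obtain ⟨l, hl, hgl⟩ := List.mem_flatten.1 hg
    rw [List.eq_of_mem_replicate hl] at hgl
    exact h.1 g hgl
  · rw [List.prod_flatten, List.map_replicate, List.prod_replicate, h.2]

theorem ProductFormula.exists_circuit {Υ : ℕ} {ι : Type*} [Fintype ι] (F : ProductFormula Υ ι)
    {K : ι → QubitOp S} (hK : ∀ q, K q ∈ skewAdjoint (QubitOp S)) (e : ι → S × S)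
    (hKe : ∀ q, SupportedOn {(e q).1, (e q).2} (K q)) (s : ℝ) :
    ∃ c : List (QubitOp S), Implements c (F.eval K s) ∧ c.length = Υ * Fintype.card ι := by
  refine ⟨((positions Υ (Fintype.card ι)).map fun x =>
    NormedSpace.exp ((s : ℂ) • F.term K x)).reverse, ⟨fun g hg => ?_, ?_⟩, ?_⟩
  · simp only [List.mem_reverse, List.mem_map] at hg
    obtain ⟨x, -, rfl⟩ := hg
    refine ⟨exp_ofReal_smul_mem_unitary (ofReal_smul_mem_skewAdjoint (hK _) _) s,
      (e (F.order x.1 x.2)).1, (e (F.order x.1 x.2)).2, ?_⟩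
    exact (((hKe _).smul _).smul _).exp
  · rw [F.eval_eq_trotter, trotter_map_eq_prod]
  · simp [positions]

theorem IsPowerLaw.exists_circuit {d : ℕ} {α : ℝ} {Λ : Finset (Fin d → ℤ)}
    {H : Λ × Λ → QubitOp Λ} (hH : IsPowerLaw α Λ H) {ι : Type*} [Fintype ι] (e : ι → Λ × Λ)
    {Υ : ℕ} (F : ProductFormula Υ ι) (s : ℝ) :
    ∃ c : List (QubitOp Λ), Implements c (F.eval (generators fun q => H (e q)) s) ∧
      c.length = Υ * Fintype.card ι :=
  F.exists_circuit (generators_mem_skewAdjoint fun q => hH.hermitian (e q)) e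
    (fun q => (hH.supported (e q)).smul _) s

/-- For a fixed first site the second one lies in a ball of radius `ℓ`. -/
theorem card_nearPairs_le {d : ℕ} (Λ : Finset (Fin d → ℤ)) {ℓ : ℝ} (hℓ : 0 ≤ ℓ) :
    (Fintype.card (nearPairs Λ ℓ) : ℝ) ≤ Λ.card * (2 * ℓ + 1) ^ d := by
  classical
  rw [Fintype.card_coe, Finset.card_eq_sum_card_fiberwise (f := Prod.fst) (t := Finset.univ)
    (fun _ _ => Finset.mem_coe.2 (Finset.mem_univ _))]
  push_cast
  calc _ ≤ ∑ _i : Λ, (2 * ℓ + 1) ^ d := Finset.sum_le_sum fun i _ => ?_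
    _ = _ := by simp
  refine le_trans ?_ (card_le_of_siteDist_le (i : Fin d → ℤ)
    (((nearPairs Λ ℓ).filter fun q => q.1 = i).image fun q => (q.2 : Fin d → ℤ)) hℓ ?_)
  · rw [Finset.card_image_of_injOn]
    intro q hq q' hq' h
    simp only [Finset.coe_filter, Set.mem_ofPred_eq] at hq hq'
    exact Prod.ext (hq.2.trans hq'.2.symm) (Subtype.ext h)
  · intro j hj
    obtain ⟨q, hq, rfl⟩ := Finset.mem_image.1 hj
    rw [Finset.mem_filter, nearPairs, Finset.mem_filter] at hq
    rw [← hq.2]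
    exact hq.1.2

end Gates

/-! ### Gate complexity with arbitrarily small loss in the exponents -/

section Complexity

/-- This is where the lower bound `t₀` on the time enters: lower powers of `t`, including constants
caused by rounding, are absorbed in the highest one. -/
theorem rpow_le_mul_rpow_of_le {t₀ t a b : ℝ} (ht₀ : 0 < t₀) (ht : t₀ ≤ t) (hab : a ≤ b) :
    t ^ a ≤ t₀ ^ (a - b) * t ^ b := by
  have ht' : 0 < t := ht₀.trans_le ht
  calc t ^ a = t ^ (a - b) * t ^ b := by rw [← Real.rpow_add ht', sub_add_cancel]
    _ ≤ t₀ ^ (a - b) * t ^ b :=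
      mul_le_mul_of_nonneg_right (Real.rpow_le_rpow_of_nonpos ht₀ ht (by linarith)) (by positivity)

theorem exists_stepRate_le {d : ℕ} (hd : 0 < d) {α δ ε : ℝ} (hα : 0 ≤ α) (hδ : 0 < δ) (hε : 0 < ε)
    {p : ℕ} (hp : 1 ≤ p) (hpδ : 2 / (p : ℝ) ≤ δ) :
    ∃ D : ℝ, 0 < D ∧ ∀ n : ℕ, 0 < n → ∀ t : ℝ, 0 < t →
      stepRate d α p n t ε ≤
        D * ((n : ℝ) ^ ((if α < d then 1 - α / d else 0) + δ) * t ^ (1 + 1 / (p : ℝ))) := by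
  have hd' : (0 : ℝ) < d := by exact_mod_cast hd
  have hp' : (1 : ℝ) ≤ p := by exact_mod_cast hp
  have hp0 : (0 : ℝ) < 1 / p := by positivity
  have hpδ' : 1 / (p : ℝ) ≤ δ / 2 := by
    have : 2 / (p : ℝ) = 2 * (1 / p) := by ring
    linarith
  have hE : 0 < ε ^ (1 / (p : ℝ)) := by positivity
  have hα' : 0 ≤ α / d := by positivity
  rcases lt_trichotomy α d with h | h | h
  · refine ⟨1 / ε ^ (1 / (p : ℝ)), by positivity, fun n hn t ht => ?_⟩
    have hn' : (1 : ℝ) ≤ n := by exact_mod_cast hn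
    rw [stepRate, if_pos h, if_pos h, one_div_mul_eq_div (ε ^ (1 / (p : ℝ)))]
    refine div_le_div_of_nonneg_right (mul_le_mul_of_nonneg_right
      (Real.rpow_le_rpow_of_exponent_le hn' ?_) (by positivity)) hE.le
    have : 1 / (p : ℝ) * (α / d) ≥ 0 := by positivity
    linarith
  · set η := δ / 4 with hη
    have hη0 : 0 < η := by positivity
    refine ⟨(1 / η) ^ (1 + 1 / (p : ℝ)) / ε ^ (1 / (p : ℝ)), by positivity, fun n hn t ht => ?_⟩
    have hn' : (1 : ℝ) ≤ n := by exact_mod_cast hn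
    have hn0 : (0 : ℝ) < n := by linarith
    rw [stepRate, if_neg h.not_lt, if_pos h, if_neg h.not_lt, zero_add, div_mul_eq_mul_div,
      ← mul_assoc]
    have hlog : Real.log n ^ (1 + 1 / (p : ℝ)) ≤
        (1 / η) ^ (1 + 1 / (p : ℝ)) * (n : ℝ) ^ (η * (1 + 1 / (p : ℝ))) := by
      rw [Real.rpow_mul hn0.le, ← Real.mul_rpow (by positivity) (by positivity)]
      refine Real.rpow_le_rpow (Real.log_nonneg hn') ?_ (by positivity)
      refine (Real.log_le_rpow_div hn0.le hη0).trans (le_of_eq ?_)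
      ring
    have hp1 : 1 / (p : ℝ) ≤ 1 := by rw [div_le_one (by linarith)]; exact hp'
    have hexp : (n : ℝ) ^ (1 / (p : ℝ)) * (n : ℝ) ^ (η * (1 + 1 / (p : ℝ))) ≤ (n : ℝ) ^ δ := by
      rw [← Real.rpow_add hn0]
      refine Real.rpow_le_rpow_of_exponent_le hn' ?_
      nlinarith
    gcongr ?_ * _ / _
    calc (n : ℝ) ^ (1 / (p : ℝ)) * Real.log n ^ (1 + 1 / (p : ℝ)) ≤
        (n : ℝ) ^ (1 / (p : ℝ)) *
          ((1 / η) ^ (1 + 1 / (p : ℝ)) * (n : ℝ) ^ (η * (1 + 1 / (p : ℝ)))) := by gcongr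
      _ = (1 / η) ^ (1 + 1 / (p : ℝ)) *
          ((n : ℝ) ^ (1 / (p : ℝ)) * (n : ℝ) ^ (η * (1 + 1 / (p : ℝ)))) := by ring
      _ ≤ _ := by gcongr
  · refine ⟨1 / ε ^ (1 / (p : ℝ)), by positivity, fun n hn t ht => ?_⟩
    have hn' : (1 : ℝ) ≤ n := by exact_mod_cast hn
    rw [stepRate, if_neg h.not_gt, if_neg h.ne', if_neg h.not_gt, one_div_mul_eq_div]
    refine div_le_div_of_nonneg_right (mul_le_mul_of_nonneg_right
      (Real.rpow_le_rpow_of_exponent_le hn' ?_) (by positivity)) hE.le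
    linarith

theorem gateRate_eq (d : ℕ) (α δ : ℝ) {n : ℕ} (hn : 0 < n) (t : ℝ) :
    gateRate d α δ n t =
      (n : ℝ) ^ 2 * (n : ℝ) ^ ((if α < d then 1 - α / d else 0) + δ) * t ^ (1 + δ) := by
  have hn' : (0 : ℝ) < n := by exact_mod_cast hn
  rw [← Real.rpow_natCast (n : ℝ) 2, ← Real.rpow_add hn', gateRate]
  split_ifs
  · congr 2
    push_cast
    ring
  · congr 2
    push_cast
    ring

/-- The factor `n ^ 2` counts the pairs in a step, and the added `1` pays for rounding the number of
steps up to a positive integer. -/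
theorem exists_gateRate_bound {d : ℕ} (hd : 0 < d) {α δ ε t₀ : ℝ} (hα : 0 ≤ α) (hδ : 0 < δ)
    (hε : 0 < ε) (ht₀ : 0 < t₀) {p : ℕ} (hp : 1 ≤ p) (hpδ : 2 / (p : ℝ) ≤ δ) :
    ∃ D : ℝ, 0 < D ∧ ∀ n : ℕ, 0 < n → ∀ t : ℝ, t₀ ≤ t →
      (n : ℝ) ^ 2 * (stepRate d α p n t ε + 1) ≤ D * gateRate d α δ n t := by
  obtain ⟨D, hD, hstep⟩ := exists_stepRate_le hd hα hδ hε hp hpδ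
  have hd' : (0 : ℝ) < d := by exact_mod_cast hd
  have hp' : (0 : ℝ) < p := by exact_mod_cast hp
  have hpδ' : 1 / (p : ℝ) ≤ δ := by
    have : 2 / (p : ℝ) = 2 * (1 / p) := by ring
    have : 0 < 1 / (p : ℝ) := by positivity
    linarith
  refine ⟨D * t₀ ^ (1 + 1 / (p : ℝ) - (1 + δ)) + t₀ ^ (0 - (1 + δ)), by positivity,
    fun n hn t ht => ?_⟩
  have hn' : (1 : ℝ) ≤ n := by exact_mod_cast hn
  have ht' : 0 < t := ht₀.trans_le ht
  have h1 := rpow_le_mul_rpow_of_le ht₀ ht (by linarith : 1 + 1 / (p : ℝ) ≤ 1 + δ)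
  have h2 := rpow_le_mul_rpow_of_le ht₀ ht (by linarith : 0 ≤ 1 + δ)
  rw [Real.rpow_zero] at h2
  rw [gateRate_eq d α δ hn]
  set x := (if α < d then 1 - α / d else 0) + δ with hx
  have hx0 : 0 ≤ x := by
    rw [hx]
    split_ifs with h
    · have : α / d ≤ 1 := by rw [div_le_one hd']; exact h.le
      linarith
    · linarith
  have hnx : 1 ≤ (n : ℝ) ^ x := Real.one_le_rpow hn' hx0
  calc (n : ℝ) ^ 2 * (stepRate d α p n t ε + 1) ≤
      (n : ℝ) ^ 2 * (D * ((n : ℝ) ^ x * (t₀ ^ (1 + 1 / (p : ℝ) - (1 + δ)) * t ^ (1 + δ))) +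
        (n : ℝ) ^ x * (t₀ ^ (0 - (1 + δ)) * t ^ (1 + δ))) := by
        gcongr
        · exact (hstep n hn t ht').trans (by gcongr)
        · exact one_le_mul_of_one_le_of_one_le hnx h2
    _ = _ := by ring

theorem two_div_le_of_ceil_le {δ : ℝ} (hδ : 0 < δ) {p : ℕ} (hp : ⌈2 / δ⌉₊ + 1 ≤ p) :
    2 / (p : ℝ) ≤ δ := by
  have h1 : 2 / δ ≤ p := (Nat.le_ceil _).trans (by exact_mod_cast (by omega : ⌈2 / δ⌉₊ ≤ p))
  have hp0 : (0 : ℝ) < p := by exact_mod_cast (by omega : 0 < p)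
  rw [div_le_iff₀ hδ] at h1
  rw [div_le_iff₀ hp0]
  linarith

theorem exists_step_number {x : ℝ} (hx : 0 ≤ x) : ∃ r : ℕ, 0 < r ∧ x ≤ r ∧ (r : ℝ) ≤ x + 2 := by
  refine ⟨⌈x⌉₊ + 1, Nat.succ_pos _, ?_, ?_⟩
  · push_cast
    linarith [Nat.le_ceil x]
  · push_cast
    linarith [Nat.ceil_lt_add_one hx]

theorem stepRate_nonneg (d : ℕ) (α : ℝ) (p n : ℕ) {t ε : ℝ} (ht : 0 ≤ t) (hε : 0 < ε) :
    0 ≤ stepRate d α p n t ε := by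
  unfold stepRate
  have := Real.log_natCast_nonneg n
  split_ifs <;> positivity

/-- Gate complexity of simulation without truncation. -/
theorem exists_gate_complexity {d : ℕ} (hd : 0 < d) {α δ : ℝ} (hα : 0 ≤ α) (hδ : 0 < δ) {p : ℕ}
    (hp : ⌈2 / δ⌉₊ + 1 ≤ p) (Υ : ℕ) {ε t₀ : ℝ} (hε : 0 < ε) (ht₀ : 0 < t₀) :
    ∃ C : ℝ, 0 < C ∧ ∀ (Λ : Finset (Fin d → ℤ)), Λ.Nonempty →
      ∀ H : Λ × Λ → QubitOp Λ, IsPowerLaw α Λ H →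
      ∀ F : ProductFormula Υ (Λ × Λ), F.HasOrder p (generators H) →
      ∀ t : ℝ, t₀ ≤ t →
      ∃ (r : ℕ) (c : List (QubitOp Λ)), 0 < r ∧
        Implements c (F.eval (generators H) (t / r) ^ r) ∧
        ‖F.eval (generators H) (t / r) ^ r - evolution H t‖ ≤ ε ∧
        (c.length : ℝ) ≤ C * gateRate d α δ Λ.card t := by
  obtain ⟨C, hC, hstep⟩ := exists_step_bound hd hα (by omega : 1 ≤ p) Υ
  obtain ⟨D, hD, hrate⟩ := exists_gateRate_bound hd hα hδ hε ht₀ (by omega : 1 ≤ p)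
    (two_div_le_of_ceil_le hδ hp)
  refine ⟨(C + 2) * (Υ + 1) * D, by positivity, fun Λ hΛ H hH F hF t ht => ?_⟩
  have ht' : 0 ≤ t := ht₀.le.trans ht
  have hS := stepRate_nonneg d α p Λ.card ht' hε
  obtain ⟨r, hr, hCr, hrC⟩ := exists_step_number (mul_nonneg hC.le hS)
  obtain ⟨c, hc, hlen⟩ := hH.exists_circuit id F (t / r)
  obtain ⟨c', hc', hlen'⟩ := hc.pow r
  refine ⟨r, c', hr, hc',
    hstep Λ hΛ H hH (Λ × Λ) id Function.injective_id F hF t ε ht' hε r hr hCr, ?_⟩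
  have hcard : Fintype.card (Λ × Λ) = Λ.card ^ 2 := by
    rw [Fintype.card_prod, Fintype.card_coe, sq]
  rw [hlen', hlen, hcard]
  push_cast
  calc (r : ℝ) * (Υ * (Λ.card : ℝ) ^ 2) ≤
      ((C + 2) * (stepRate d α p Λ.card t ε + 1)) * ((Υ + 1) * (Λ.card : ℝ) ^ 2) := by
        gcongr
        · nlinarith
        · linarith
    _ = (C + 2) * (Υ + 1) * ((Λ.card : ℝ) ^ 2 * (stepRate d α p Λ.card t ε + 1)) := by ring
    _ ≤ (C + 2) * (Υ + 1) * (D * gateRate d α δ Λ.card t) :=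
        mul_le_mul_of_nonneg_left (hrate _ hΛ.card_pos t ht) (by positivity)
    _ = _ := by ring

/-- Gate count of one step of simulation with the truncated Hamiltonian. -/
theorem exists_truncated_gate_count (d : ℕ) (α : ℝ) (Υ : ℕ) :
    ∃ C : ℝ, 0 < C ∧ ∀ (Λ : Finset (Fin d → ℤ)), Λ.Nonempty →
      ∀ H : Λ × Λ → QubitOp Λ, IsPowerLaw α Λ H →
      ∀ ℓ : ℝ, 1 ≤ ℓ → ∀ (F : ProductFormula Υ (nearPairs Λ ℓ)) (s : ℝ),
      ∃ c : List (QubitOp Λ), Implements c (F.eval (generators (truncate H ℓ)) s) ∧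
        (c.length : ℝ) ≤ C * ((Λ.card : ℝ) * ℓ ^ d) := by
  refine ⟨(Υ + 1) * 3 ^ d, by positivity, fun Λ hΛ H hH ℓ hℓ F s => ?_⟩
  obtain ⟨c, hc, hlen⟩ := hH.exists_circuit Subtype.val F s
  refine ⟨c, hc, ?_⟩
  rw [hlen]
  push_cast
  have h1 := card_nearPairs_le Λ (by linarith : 0 ≤ ℓ)
  calc (Υ : ℝ) * Fintype.card (nearPairs Λ ℓ) ≤ (Υ + 1) * (Λ.card * (3 * ℓ) ^ d) := by
        gcongr
        · linarith
        · exact h1.trans (by gcongr; linarith)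
    _ = _ := by rw [mul_pow]; ring

/-- Gate complexity of simulation with the truncated Hamiltonian, given the Trotter number. -/
theorem exists_truncated_gate_complexity {d : ℕ} {α δ c₁ : ℝ} (hα : (d : ℝ) < α) (hδ : 0 < δ)
    {p : ℕ} (hp : ⌈2 / δ⌉₊ + 1 ≤ p) (Υ : ℕ) {ε t₀ C : ℝ} (hε : 0 < ε) (ht₀ : 0 < t₀) (hC : 0 < C)
    (hc₁ : 0 < c₁) :
    ∃ D : ℝ, 0 < D ∧ ∀ (Λ : Finset (Fin d → ℤ)), Λ.Nonempty →
      ∀ H : Λ × Λ → QubitOp Λ, IsPowerLaw α Λ H →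
      ∀ t : ℝ, t₀ ≤ t → ∀ ℓ : ℝ, 0 ≤ ℓ →
      ℓ ≤ c₁ * ((Λ.card : ℝ) * t / ε) ^ (1 / (α - d)) →
      ∀ F : ProductFormula Υ (nearPairs Λ ℓ),
      ∃ r : ℕ, 0 < r ∧
        C * ((Λ.card : ℝ) ^ (1 / (p : ℝ)) * t ^ (1 + 1 / (p : ℝ)) / ε ^ (1 / (p : ℝ))) ≤ r ∧
      ∃ c : List (QubitOp Λ),
        Implements c (F.eval (generators (truncate H ℓ)) (t / r) ^ r) ∧
        (c.length : ℝ) ≤ D * ((Λ.card : ℝ) * t) ^ (1 + d / (α - d) + δ) := by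
  have hαd : 0 < α - d := by linarith
  have hp' : (0 : ℝ) < p := by exact_mod_cast (by omega : 0 < p)
  have hpδ : 1 / (p : ℝ) ≤ δ := by
    have := two_div_le_of_ceil_le hδ hp
    have : 2 / (p : ℝ) = 2 * (1 / p) := by ring
    have : 0 < 1 / (p : ℝ) := by positivity
    linarith
  set β := 1 / (α - d) with hβ
  have hβ0 : 0 < β := by positivity
  set A := 2 * c₁ / ε ^ β + t₀ ^ (0 - β) with hA
  set B := C * (t₀ ^ (1 + 1 / (p : ℝ) - (1 + δ)) / ε ^ (1 / (p : ℝ))) +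
    2 * (t₀ ^ (1 - (1 + δ)) / t₀) with hB
  have hA0 : 0 < A := by positivity
  have hB0 : 0 < B := by positivity
  refine ⟨(Υ + 1) * A ^ d * B, by positivity, fun Λ hΛ H hH t ht ℓ hℓ0 hℓ F => ?_⟩
  have ht' : 0 < t := ht₀.trans_le ht
  have hn : (1 : ℝ) ≤ Λ.card := by exact_mod_cast hΛ.card_pos
  have hn0 : (0 : ℝ) < Λ.card := by linarith
  set n : ℝ := (Λ.card : ℝ)
  -- Everything is expressed through `N`, which is at least `t₀` because `n ≥ 1`.
  set N := n * t with hN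
  have hNt : t₀ ≤ N := by nlinarith
  have hN0 : 0 < N := by positivity
  obtain ⟨r, hr, hCr, hrC⟩ := exists_step_number
    (x := C * (n ^ (1 / (p : ℝ)) * t ^ (1 + 1 / (p : ℝ)) / ε ^ (1 / (p : ℝ)))) (by positivity)
  obtain ⟨c, hc, hlen⟩ := hH.exists_circuit Subtype.val F (t / r)
  obtain ⟨c', hc', hlen'⟩ := hc.pow r
  refine ⟨r, hr, hCr, c', hc', ?_⟩
  rw [hlen', hlen]
  push_cast
  have hball : 2 * ℓ + 1 ≤ A * N ^ β := by
    have h1 := rpow_le_mul_rpow_of_le ht₀ hNt hβ0.le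
    rw [Real.rpow_zero] at h1
    rw [Real.div_rpow hN0.le hε.le] at hℓ
    calc 2 * ℓ + 1 ≤ 2 * (c₁ * (N ^ β / ε ^ β)) + t₀ ^ (0 - β) * N ^ β := by linarith
      _ = _ := by rw [hA]; ring
  have hpairs : (Fintype.card (nearPairs Λ ℓ) : ℝ) ≤ n * (A ^ d * N ^ ((d : ℝ) / (α - d))) := by
    refine (card_nearPairs_le Λ hℓ0).trans ?_
    have h1 : (N ^ β) ^ d = N ^ ((d : ℝ) / (α - d)) := by
      rw [← Real.rpow_mul_natCast hN0.le, hβ, one_div_mul_eq_div]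
    rw [← h1, ← mul_pow]
    gcongr
  -- The factor `n` of the pair count supplies the missing power: `n · n ^ (1 / p) · t ^ (1 + 1 / p)
  -- = N ^ (1 + 1 / p)`.
  have hsteps : r * n ≤ B * N ^ (1 + δ) := by
    have h1 : n * (n ^ (1 / (p : ℝ)) * t ^ (1 + 1 / (p : ℝ))) = N ^ (1 + 1 / (p : ℝ)) := by
      rw [hN, Real.mul_rpow hn0.le ht'.le, Real.rpow_add hn0, Real.rpow_one]
      ring
    have h2 := rpow_le_mul_rpow_of_le ht₀ hNt (by linarith : 1 + 1 / (p : ℝ) ≤ 1 + δ)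
    have h3 := rpow_le_mul_rpow_of_le ht₀ hNt (by linarith : 1 ≤ 1 + δ)
    rw [Real.rpow_one] at h3
    have h4 : n ≤ N / t₀ := by
      rw [le_div_iff₀ ht₀, hN]
      gcongr
    calc r * n ≤ (C * (n ^ (1 / (p : ℝ)) * t ^ (1 + 1 / (p : ℝ)) / ε ^ (1 / (p : ℝ))) + 2) * n := by
          gcongr
      _ = C * ((n * (n ^ (1 / (p : ℝ)) * t ^ (1 + 1 / (p : ℝ)))) / ε ^ (1 / (p : ℝ))) + 2 * n := by
          ring
      _ ≤ C * ((t₀ ^ (1 + 1 / (p : ℝ) - (1 + δ)) * N ^ (1 + δ)) / ε ^ (1 / (p : ℝ))) +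
          2 * ((t₀ ^ (1 - (1 + δ)) * N ^ (1 + δ)) / t₀) := by
          rw [h1]
          gcongr
          exact h4.trans (by gcongr)
      _ = _ := by rw [hB]; ring
  calc (r : ℝ) * (Υ * Fintype.card (nearPairs Λ ℓ)) ≤
      r * ((Υ + 1) * (n * (A ^ d * N ^ ((d : ℝ) / (α - d))))) := by
        gcongr
        linarith
    _ = (r * n) * ((Υ + 1) * (A ^ d * N ^ ((d : ℝ) / (α - d)))) := by ring
    _ ≤ (B * N ^ (1 + δ)) * ((Υ + 1) * (A ^ d * N ^ ((d : ℝ) / (α - d)))) := by gcongr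
    _ = (Υ + 1) * A ^ d * B * (N ^ (1 + δ) * N ^ ((d : ℝ) / (α - d))) := by ring
    _ = _ := by
        rw [← Real.rpow_add hN0]
        congr 2
        ring

end Complexity

/-! ### Leading error terms under composition -/

section Expansion

variable {𝔸 : Type*} [CStarAlgebra 𝔸]

theorem isBigO_pow_succ (k : ℕ) :
    (fun t : ℝ => t ^ (k + 1)) =O[𝓝 0] fun t : ℝ => t ^ k :=
  (Asymptotics.isLittleO_pow_pow (Nat.lt_succ_self k)).isBigO

theorem AnalyticAt.exists_isBigO_sub {E : Type*} [NormedAddCommGroup E] [NormedSpace ℝ E]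
    {f : ℝ → E} (hf : AnalyticAt ℝ f 0) {k : ℕ} (hO : f =O[𝓝 0] fun t : ℝ => t ^ k) :
    ∃ e : E, (fun t : ℝ => f t - t ^ k • e) =O[𝓝 0] fun t : ℝ => t ^ (k + 1) := by
  obtain ⟨g, hg, hfg⟩ := hf.exists_eq_pow_smul_of_isBigO hO
  refine ⟨g 0, ?_⟩
  have h1 : (fun t : ℝ => g t - g 0) =O[𝓝 0] fun t : ℝ => t := by
    simpa using hg.differentiableAt.isBigO_sub
  have h2 := (Asymptotics.isBigO_refl (fun t : ℝ => t ^ k) (𝓝 0)).smul h1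
  refine Filter.EventuallyEq.trans_isBigO ?_ (h2.trans_eventuallyEq ?_)
  · filter_upwards [hfg] with t ht
    rw [ht, smul_sub]
  · exact Filter.Eventually.of_forall fun t => by simp [pow_succ]

/-- `X t = exp (a t K) + t ^ m E + O(t ^ (m + 1))`. -/
def HasExpansion (K : 𝔸) (m : ℕ) (a : ℝ) (E : 𝔸) (X : ℝ → 𝔸) : Prop :=
  (fun t : ℝ => X t - NormedSpace.exp (((a * t : ℝ) : ℂ) • K) - t ^ m • E) =O[𝓝 0]
    fun t : ℝ => t ^ (m + 1)

theorem exp_mul_isBigO_one (K : 𝔸) (a : ℝ) :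
    (fun t : ℝ => NormedSpace.exp (((a * t : ℝ) : ℂ) • K) - 1) =O[𝓝 0] fun t : ℝ => t := by
  have h : HasDerivAt (fun t : ℝ => NormedSpace.exp (((a * t : ℝ) : ℂ) • K)) _ 0 :=
    (hasDerivAt_exp_ofReal_smul K (a * 0)).scomp 0 ((hasDerivAt_id (0 : ℝ)).const_mul a)
  simpa using h.differentiableAt.isBigO_sub

theorem continuous_exp_ofReal_smul (K : 𝔸) :
    Continuous fun t : ℝ => NormedSpace.exp ((t : ℂ) • K) :=
  continuous_iff_continuousAt.2 fun t => (hasDerivAt_exp_ofReal_smul K t).continuousAt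

theorem exp_isBigO_one (K : 𝔸) (a : ℝ) :
    (fun t : ℝ => NormedSpace.exp (((a * t : ℝ) : ℂ) • K)) =O[𝓝 0] fun _ : ℝ => (1 : ℝ) :=
  (((continuous_exp_ofReal_smul K).comp (continuous_const.mul continuous_id)).tendsto
    (0 : ℝ)).isBigO_one ℝ

theorem exp_ofReal_add_smul (K : 𝔸) (s t : ℝ) :
    NormedSpace.exp (((s + t : ℝ) : ℂ) • K) =
      NormedSpace.exp ((s : ℂ) • K) * NormedSpace.exp ((t : ℂ) • K) := by
  let : NormedAlgebra ℚ 𝔸 := .restrictScalars ℚ ℂ 𝔸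
  rw [Complex.ofReal_add, add_smul]
  exact NormedSpace.exp_add_of_commute (((Commute.refl K).smul_left _).smul_right _)

theorem HasExpansion.isBigO_sub_exp {K E : 𝔸} {m : ℕ} {a : ℝ} {X : ℝ → 𝔸}
    (hX : HasExpansion K m a E X) :
    (fun t : ℝ => X t - NormedSpace.exp (((a * t : ℝ) : ℂ) • K)) =O[𝓝 0] fun t : ℝ => t ^ m := by
  have h1 : (fun t : ℝ => t ^ m • E) =O[𝓝 0] fun t : ℝ => t ^ m := by
    simpa using (Asymptotics.isBigO_refl (fun t : ℝ => t ^ m) (𝓝 0)).smul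
      (Asymptotics.isBigO_const_const E (one_ne_zero (α := ℝ)) _)
  simpa using (hX.trans (isBigO_pow_succ m)).add h1

theorem HasExpansion.isBigO_sub_one {K E : 𝔸} {m : ℕ} (hm : 1 ≤ m) {a : ℝ} {X : ℝ → 𝔸}
    (hX : HasExpansion K m a E X) : (fun t : ℝ => X t - 1) =O[𝓝 0] fun t : ℝ => t := by
  have hpow : (fun t : ℝ => t ^ m) =O[𝓝 0] fun t : ℝ => t := by
    rcases hm.eq_or_lt with rfl | h
    · simpa using Asymptotics.isBigO_refl (fun t : ℝ => t) (𝓝 0)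
    · simpa using (Asymptotics.isLittleO_pow_pow (𝕜 := ℝ) h).isBigO
  simpa using (hX.isBigO_sub_exp.trans hpow).add (exp_mul_isBigO_one K a)

theorem isBigO_one_of_sub_one {X : ℝ → 𝔸} (h : (fun t : ℝ => X t - 1) =O[𝓝 0] fun t : ℝ => t) :
    X =O[𝓝 0] fun _ : ℝ => (1 : ℝ) := by
  have h1 : (fun t : ℝ => t) =O[𝓝 0] fun _ : ℝ => (1 : ℝ) :=
    (continuous_id.tendsto (0 : ℝ)).isBigO_one ℝ
  have h2 := (h.trans h1).add
    (Asymptotics.isBigO_const_const (1 : 𝔸) (one_ne_zero (α := ℝ)) (𝓝 (0 : ℝ)))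
  simpa using h2

/-- Leading errors add: each is multiplied by a factor `1 + O(t)`, and the replacement of that
factor by `1` costs only `O(t ^ (m + 1))`. -/
theorem HasExpansion.mul {K E E' : 𝔸} {m : ℕ} (hm : 1 ≤ m) {a a' : ℝ} {X X' : ℝ → 𝔸}
    (hX : HasExpansion K m a E X) (hX' : HasExpansion K m a' E' X') :
    HasExpansion K m (a + a') (E + E') fun t => X t * X' t := by
  have hone := isBigO_one_of_sub_one (hX'.isBigO_sub_one hm)
  have ht := Asymptotics.isBigO_refl (fun t : ℝ => t ^ m) (𝓝 0)
  have hE : ∀ E : 𝔸, (fun _ : ℝ => E) =O[𝓝 (0 : ℝ)] fun _ : ℝ => (1 : ℝ) := fun E =>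
    Asymptotics.isBigO_const_const E (one_ne_zero (α := ℝ)) _
  have h1 := Asymptotics.IsBigO.mul (show _ =O[_] _ from hX) hone
  have h2 := (exp_isBigO_one K a).mul hX'
  have h3 := ht.smul ((hE E).mul (hX'.isBigO_sub_one hm))
  have h4 := ht.smul ((exp_mul_isBigO_one K a).mul (hE E'))
  simp only [mul_one, one_mul, smul_eq_mul, ← pow_succ] at h1 h2 h3 h4
  refine (((h1.add h2).add h3).add h4).congr_left fun t => ?_
  rw [add_mul, exp_ofReal_add_smul]
  simp only [mul_sub, sub_mul, smul_sub, smul_add, mul_smul_comm, smul_mul_assoc, mul_one, one_mul]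
  abel

theorem HasExpansion.comp_mul {K E : 𝔸} {m : ℕ} {a : ℝ} {X : ℝ → 𝔸} (hX : HasExpansion K m a E X)
    (c : ℝ) : HasExpansion K m (c * a) (c ^ m • E) fun t => X (c * t) := by
  have htend : Filter.Tendsto (fun t : ℝ => c * t) (𝓝 0) (𝓝 0) := by
    simpa using (continuous_const_mul c).tendsto (0 : ℝ)
  have h1 := hX.comp_tendsto htend
  have h2 : ((fun t : ℝ => t ^ (m + 1)) ∘ fun t : ℝ => c * t) =O[𝓝 0] fun t : ℝ => t ^ (m + 1) := by
    simp only [Function.comp_def, mul_pow]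
    exact Asymptotics.isBigO_const_mul_self _ _ _
  refine (h1.trans h2).congr_left fun t => ?_
  simp only [Function.comp_apply, smul_smul, mul_pow]
  rw [mul_comm (t ^ m), ← mul_assoc a, mul_comm a]

/-- `V` is the time-reversed inverse of `U`. Multiplying the expansion of `U (-t)` by `V t` on the
left and `exp (t K)` on the right gives `V t = exp (t K) - t ^ m (-1) ^ m E` up to higher order. -/
theorem HasExpansion.of_mul_comp_neg_eq_one {K E : 𝔸} {m : ℕ} {U V : ℝ → 𝔸}
    (hU : HasExpansion K m 1 E U) (hV : AnalyticAt ℝ V 0) (hV0 : V 0 = 1)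
    (hVU : ∀ t, V t * U (-t) = 1) : HasExpansion K m 1 (-((-1 : ℝ) ^ m • E)) V := by
  have hV1 : (fun t : ℝ => V t - 1) =O[𝓝 0] fun t : ℝ => t := by
    simpa [hV0] using hV.differentiableAt.isBigO_sub
  have hU' := hU.comp_mul (-1)
  generalize (-1 : ℝ) ^ m • E = E' at hU' ⊢
  have hE : (fun _ : ℝ => E') =O[𝓝 (0 : ℝ)] fun _ : ℝ => (1 : ℝ) :=
    Asymptotics.isBigO_const_const _ (one_ne_zero (α := ℝ)) _
  have ht := Asymptotics.isBigO_refl (fun t : ℝ => t ^ m) (𝓝 0)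
  have hexp := exp_isBigO_one K 1
  have h1 := ((isBigO_one_of_sub_one hV1).mul hU').mul hexp
  have h2 := ht.smul ((hV1.mul hE).mul hexp)
  have h3 := ht.smul (hE.mul (exp_mul_isBigO_one K 1))
  simp only [mul_one, one_mul, smul_eq_mul, ← pow_succ] at h1 h2 h3
  refine (((h1.add h2).add h3).neg_left).congr_left fun t => ?_
  have hinv : NormedSpace.exp (((-t : ℝ) : ℂ) • K) * NormedSpace.exp ((t : ℂ) • K) = 1 := by
    rw [← exp_ofReal_add_smul]
    simp
  have h4 : V t * NormedSpace.exp (((-t : ℝ) : ℂ) • K) * NormedSpace.exp ((t : ℂ) • K) = V t := by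
    rw [mul_assoc, hinv, mul_one]
  have h5 := hVU t
  simp only [neg_mul, one_mul, mul_sub, sub_mul, smul_sub, mul_smul_comm, smul_mul_assoc, mul_one,
    h4, h5, smul_neg]
  abel

/-- The coefficient `u` of Suzuki's recursion: `4 u ^ m + (1 - 4 u) ^ m = 0`. -/
theorem exists_suzuki_coeff {m : ℕ} (hm : 3 ≤ m) (hodd : Odd m) :
    ∃ u : ℝ, |u| ≤ 1 ∧ |1 - 4 * u| ≤ 1 ∧ 4 * u ^ m + (1 - 4 * u) ^ m = 0 := by
  -- For odd `m` the equation becomes `4 u - 1 = w u`, so `u = 1 / (4 - w)`. Since `m ≥ 3`, `w ≤ 2`,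
  -- which gives both coefficient bounds.
  set w : ℝ := 4 ^ (1 / (m : ℝ)) with hw
  have hm' : (3 : ℝ) ≤ m := by exact_mod_cast hm
  have hw0 : 0 < w := by positivity
  have hwm : w ^ m = 4 := by
    rw [hw, one_div]
    exact Real.rpow_inv_natCast_pow (by norm_num) (by omega)
  have hw2 : w ≤ 2 := by
    by_contra! h
    have h1 : (2 : ℝ) ^ m < w ^ m := pow_lt_pow_left₀ h (by norm_num) (by omega)
    have h2 : (2 : ℝ) ^ 3 ≤ 2 ^ m := pow_le_pow_right₀ (by norm_num) hm
    rw [hwm] at h1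
    linarith
  have h4 : 0 < 4 - w := by linarith
  have hu : 1 - 4 * (1 / (4 - w)) = -(w * (1 / (4 - w))) := by
    field_simp
    ring
  have hu1 : 1 / (4 - w) ≤ 1 / 2 := by
    apply one_div_le_one_div_of_le <;> linarith
  have hu0 : 0 < 1 / (4 - w) := by positivity
  refine ⟨1 / (4 - w), ?_, ?_, ?_⟩
  · rw [abs_of_pos hu0]
    linarith
  · rw [hu, abs_neg, abs_of_nonneg (by positivity)]
    nlinarith
  · rw [hu, hodd.neg_pow, mul_pow, hwm]
    ring

end Expansion

/-! ### Product formulas of arbitrary order -/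

section Stages

/-- The stages of a product formula: an ordering of the summands, and coefficients. -/
abbrev Stage (ι : Type*) [Fintype ι] : Type _ :=
  (Fin (Fintype.card ι) ≃ ι) × (Fin (Fintype.card ι) → ℝ)

namespace Stage

variable {ι : Type*} [Fintype ι] {𝔸 : Type*} [CStarAlgebra 𝔸]

/-- The product of the exponentials of one stage. -/
noncomputable def eval (K : ι → 𝔸) (s : Stage ι) (t : ℝ) : 𝔸 :=
  ((List.finRange (Fintype.card ι)).map fun γ =>
    NormedSpace.exp (((t * s.2 γ : ℝ) : ℂ) • K (s.1 γ))).reverse.prod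

/-- The product of the exponentials of a list of stages. -/
noncomputable def evalList (K : ι → 𝔸) (l : List (Stage ι)) (t : ℝ) : 𝔸 :=
  (l.map fun s => s.eval K t).reverse.prod

/-- Multiplication of all coefficients by `c`. -/
def scale (c : ℝ) (s : Stage ι) : Stage ι := (s.1, fun γ => c * s.2 γ)

/-- Reversal of the order of the exponentials. -/
def rev (s : Stage ι) : Stage ι := (Fin.revPerm.trans s.1, fun γ => s.2 γ.rev)

theorem evalList_append (K : ι → 𝔸) (l l' : List (Stage ι)) (t : ℝ) :
    evalList K (l ++ l') t = evalList K l' t * evalList K l t := by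
  simp [evalList]

theorem evalList_scale (K : ι → 𝔸) (c : ℝ) (l : List (Stage ι)) (t : ℝ) :
    evalList K (l.map (scale c)) t = evalList K l (c * t) := by
  simp only [evalList, eval, scale, List.map_map, Function.comp_def, mul_left_comm t c, mul_assoc]

theorem _root_.List.prod_mul_reverse_prod_eq_one {M κ : Type*} [Monoid M] (l : List κ)
    (f g : κ → M) (h : ∀ x, f x * g x = 1) : (l.map f).prod * (l.map g).reverse.prod = 1 := by
  induction l with
  | nil => simp
  | cons x l ih =>
    simp only [List.map_cons, List.prod_cons, List.reverse_cons, List.prod_append, List.prod_nil,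
      mul_one]
    rw [mul_assoc, ← mul_assoc _ _ (g x), ih, one_mul, h]

theorem eval_rev (K : ι → 𝔸) (s : Stage ι) (t : ℝ) :
    s.rev.eval K t = ((List.finRange (Fintype.card ι)).map fun γ =>
      NormedSpace.exp (((t * s.2 γ : ℝ) : ℂ) • K (s.1 γ))).prod := by
  rw [eval, ← List.map_reverse, List.finRange_reverse, List.map_map]
  simp [rev, Function.comp_def]

/-- Reversing both the stages and the order within each stage gives the inverse at time `-t`. -/
theorem evalList_rev_mul (K : ι → 𝔸) (l : List (Stage ι)) (t : ℝ) :
    evalList K (l.map rev).reverse t * evalList K l (-t) = 1 := by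
  simp only [evalList, List.map_reverse, List.reverse_reverse, List.map_map, Function.comp_def]
  refine List.prod_mul_reverse_prod_eq_one l _ _ fun s => ?_
  rw [eval_rev]
  refine List.prod_mul_reverse_prod_eq_one _ _ _ fun γ => ?_
  rw [← exp_ofReal_add_smul]
  simp

theorem evalList_eq_trotter (K : ι → 𝔸) (l : List (Stage ι)) (t : ℝ) :
    evalList K l t = trotter (l.flatMap fun s =>
      (List.finRange (Fintype.card ι)).map fun γ => (s.2 γ : ℂ) • K (s.1 γ)) t := by
  rw [trotter_flatMap_eq_prod]
  simp only [evalList, eval, trotter_map_eq_prod, smul_smul, Complex.ofReal_mul]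

theorem analyticAt_evalList (K : ι → 𝔸) (l : List (Stage ι)) (t : ℝ) :
    AnalyticAt ℝ (evalList K l) t := by
  rw [funext (evalList_eq_trotter K l)]
  exact analyticAt_trotter _ t

theorem evalList_zero (K : ι → 𝔸) (l : List (Stage ι)) : evalList K l 0 = 1 := by
  rw [evalList_eq_trotter, trotter_zero]

theorem _root_.hasDerivAt_trotter_zero (L : List 𝔸) : HasDerivAt (trotter L) L.sum 0 := by
  induction L with
  | nil => simpa [trotter] using hasDerivAt_const (0 : ℝ) (1 : 𝔸)
  | cons A L ih =>
    refine (ih.mul (hasDerivAt_exp_ofReal_smul A 0)).congr_deriv ?_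
    simp [trotter_zero, add_comm]

/-- The stages `l` approximate `exp (t ∑ K)` to order `p`. -/
def IsOrder (l : List (Stage ι)) (p : ℕ) (K : ι → 𝔸) : Prop :=
  (fun t : ℝ => evalList K l t - NormedSpace.exp ((t : ℂ) • ∑ q, K q)) =O[𝓝 0]
    fun t : ℝ => t ^ (p + 1)

theorem IsOrder.exists_hasExpansion {l : List (Stage ι)} {p : ℕ} {K : ι → 𝔸}
    (h : IsOrder l p K) : ∃ E, HasExpansion (∑ q, K q) (p + 1) 1 E (evalList K l) := by
  have han := (analyticAt_evalList K l 0).fun_sub (analyticAt_exp_ofReal_smul (∑ q, K q) 0)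
  obtain ⟨E, hE⟩ := han.exists_isBigO_sub h
  exact ⟨E, by simpa only [HasExpansion, one_mul] using hE⟩

theorem isOrder_succ_of_hasExpansion {l : List (Stage ι)} {p : ℕ} {K : ι → 𝔸}
    (h : HasExpansion (∑ q, K q) (p + 1) 1 0 (evalList K l)) : IsOrder l (p + 1) K := by
  simpa only [IsOrder, HasExpansion, one_mul, smul_zero, sub_zero] using h

/-- If the leading error has even degree, a formula and its time-reversed inverse have opposite
leading errors, so composing them over half the time each cancels it. -/
theorem IsOrder.symmetrize {l : List (Stage ι)} {p : ℕ} (hp : Even (p + 1)) {K : ι → 𝔸}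
    (h : IsOrder l p K) :
    IsOrder (l.map (scale (1 / 2)) ++ (l.map rev).reverse.map (scale (1 / 2))) (p + 1) K := by
  obtain ⟨E, hE⟩ := h.exists_hasExpansion
  have hV := hE.of_mul_comp_neg_eq_one (analyticAt_evalList K (l.map rev).reverse 0)
    (evalList_zero _ _) (evalList_rev_mul K l)
  have hW := (hV.comp_mul (1 / 2)).mul (by omega) (hE.comp_mul (1 / 2))
  refine isOrder_succ_of_hasExpansion ?_
  convert! hW using 1
  · norm_num
  · rw [hp.neg_one_pow, one_smul, smul_neg, neg_add_cancel]
  · funext t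
    rw [evalList_append, evalList_scale, evalList_scale]

/-- The five leading errors add up to `4 u ^ (p + 1) + (1 - 4 u) ^ (p + 1) = 0` times a common
operator, while the five durations add up to `t`. -/
theorem IsOrder.suzuki {l : List (Stage ι)} {p : ℕ} {u : ℝ}
    (hu : 4 * u ^ (p + 1) + (1 - 4 * u) ^ (p + 1) = 0) {K : ι → 𝔸} (h : IsOrder l p K) :
    IsOrder (l.map (scale u) ++ (l.map (scale u) ++ (l.map (scale (1 - 4 * u)) ++
      (l.map (scale u) ++ l.map (scale u))))) (p + 1) K := by
  obtain ⟨E, hE⟩ := h.exists_hasExpansion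
  have hm : 1 ≤ p + 1 := by omega
  have h1 := hE.comp_mul u
  have hW := (((h1.mul hm h1).mul hm (hE.comp_mul (1 - 4 * u))).mul hm h1).mul hm h1
  refine isOrder_succ_of_hasExpansion ?_
  convert! hW using 1
  · ring
  · rw [← add_smul, ← add_smul, ← add_smul, ← add_smul]
    rw [show u ^ (p + 1) + u ^ (p + 1) + (1 - 4 * u) ^ (p + 1) + u ^ (p + 1) + u ^ (p + 1) = 0 by
      linarith, zero_smul]
  · funext t
    simp only [evalList_append, evalList_scale]

/-- The Lie–Trotter formula. -/
theorem isOrder_one (o : Fin (Fintype.card ι) ≃ ι) (K : ι → 𝔸) :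
    IsOrder [((o, fun _ => 1) : Stage ι)] 1 K := by
  have han := (analyticAt_evalList K [((o, fun _ => 1) : Stage ι)] 0).fun_sub
    (analyticAt_exp_ofReal_smul (∑ q, K q) 0)
  have hderiv : HasDerivAt (fun t : ℝ => evalList K [((o, fun _ => 1) : Stage ι)] t -
      NormedSpace.exp ((t : ℂ) • ∑ q, K q)) 0 0 := by
    have h1 := (hasDerivAt_trotter_zero ([((o, fun _ => 1) : Stage ι)].flatMap fun s =>
      (List.finRange (Fintype.card ι)).map fun γ => (s.2 γ : ℂ) • K (s.1 γ))).fun_sub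
      (hasDerivAt_exp_ofReal_smul (∑ q, K q) 0)
    simp only [evalList_eq_trotter]
    refine h1.congr_deriv ?_
    simp [← Fin.sum_univ_def, Equiv.sum_comp o K]
  have hO : (fun t : ℝ => evalList K [((o, fun _ => 1) : Stage ι)] t -
      NormedSpace.exp ((t : ℂ) • ∑ q, K q)) =o[𝓝 0] fun t : ℝ => t := by
    simpa [evalList_zero] using hderiv.isLittleO
  obtain ⟨E, hE⟩ := han.exists_isBigO_sub (k := 1) (by simpa using hO.isBigO)
  -- Equality of first derivatives gives only `o(t)`. Analyticity provides an expansion whose linear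
  -- coefficient is that derivative, and its vanishing yields `O(t ^ 2)`.
  have hE0 : E = 0 := by
    have h1 : (fun t : ℝ => t ^ (1 + 1)) =o[𝓝 0] fun t : ℝ => t := by
      simpa using Asymptotics.isLittleO_pow_pow (𝕜 := ℝ) (by norm_num : 1 < 2)
    have h2 : HasDerivAt (fun t : ℝ => evalList K [((o, fun _ => 1) : Stage ι)] t -
        NormedSpace.exp ((t : ℂ) • ∑ q, K q)) E 0 := by
      rw [hasDerivAt_iff_isLittleO]
      simpa [evalList_zero] using hE.trans_isLittleO h1
    exact h2.unique hderiv
  simpa only [IsOrder, hE0, smul_zero, sub_zero] using hE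

end Stage

/-- There are stages of every positive order, in a number that does not depend on the summands. -/
theorem exists_stages (p : ℕ) :
    ∃ Υ : ℕ, ∀ (ι : Type) [Fintype ι], ∃ l : List (Stage ι), l.length = Υ ∧
      (∀ s ∈ l, ∀ γ, |s.2 γ| ≤ 1) ∧
      ∀ (𝔸 : Type) [CStarAlgebra 𝔸] (K : ι → 𝔸), Stage.IsOrder l (p + 1) K := by
  have hscale : ∀ {ι : Type} [Fintype ι] {l : List (Stage ι)} {c : ℝ}, |c| ≤ 1 →
      (∀ s ∈ l, ∀ γ, |s.2 γ| ≤ 1) → ∀ s ∈ l.map (Stage.scale c), ∀ γ, |s.2 γ| ≤ 1 := by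
    intro ι _ l c hc hl s hs γ
    obtain ⟨s', hs', rfl⟩ := List.mem_map.1 hs
    rw [Stage.scale, abs_mul]
    exact mul_le_one₀ hc (abs_nonneg _) (hl s' hs' γ)
  have happend : ∀ {ι : Type} [Fintype ι] {l l' : List (Stage ι)},
      (∀ s ∈ l, ∀ γ, |s.2 γ| ≤ 1) → (∀ s ∈ l', ∀ γ, |s.2 γ| ≤ 1) →
      ∀ s ∈ l ++ l', ∀ γ, |s.2 γ| ≤ 1 := by
    intro ι _ l l' hl hl' s hs
    exact (List.mem_append.1 hs).elim (hl s) (hl' s)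
  induction p with
  | zero =>
    refine ⟨1, fun ι _ => ⟨[((Fintype.equivFin ι).symm, fun _ => 1)], rfl, ?_, ?_⟩⟩
    · simp
    · exact fun 𝔸 _ K => Stage.isOrder_one _ K
  | succ p ih =>
    obtain ⟨Υ, hΥ⟩ := ih
    -- The parity of the degree of the leading error decides which composition removes it; a real
    -- Suzuki coefficient exists only in the odd case.
    rcases Nat.even_or_odd (p + 1 + 1) with hpar | hpar
    · refine ⟨Υ + Υ, fun ι _ => ?_⟩
      obtain ⟨l, hlen, hl, hord⟩ := hΥ ι
      have hhalf : |(1 / 2 : ℝ)| ≤ 1 := by rw [abs_of_pos] <;> norm_num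
      refine ⟨_, ?_, ?_, fun 𝔸 _ K => (hord 𝔸 K).symmetrize hpar⟩
      · simp [hlen]
      · refine happend (hscale hhalf hl) (hscale hhalf fun s hs γ => ?_)
        obtain ⟨s', hs', rfl⟩ := List.mem_map.1 (List.mem_reverse.1 hs)
        exact hl s' hs' _
    · refine ⟨Υ + (Υ + (Υ + (Υ + Υ))), fun ι _ => ?_⟩
      obtain ⟨l, hlen, hl, hord⟩ := hΥ ι
      obtain ⟨u, hu, hu', hsum⟩ := exists_suzuki_coeff (m := p + 1 + 1)
        (by rcases hpar with ⟨k, hk⟩; omega) hpar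
      refine ⟨_, ?_, ?_, fun 𝔸 _ K => (hord 𝔸 K).suzuki hsum⟩
      · simp [hlen]
      · have h1 := hscale hu hl
        exact happend h1 (happend h1 (happend (hscale hu' hl) (happend h1 h1)))

theorem exists_productFormula_of_stages {ι : Type*} [Fintype ι] {Υ : ℕ} (l : List (Stage ι))
    (hlen : l.length = Υ) (hl : ∀ s ∈ l, ∀ γ, |s.2 γ| ≤ 1) :
    ∃ F : ProductFormula Υ ι, ∀ {S : Type} [Fintype S] [DecidableEq S] (K : ι → QubitOp S) (t : ℝ),
      F.eval K t = Stage.evalList K l t := by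
  subst hlen
  refine ⟨⟨fun υ => (l.get υ).1, fun υ => (l.get υ).2, fun υ => hl _ (l.get_mem υ)⟩,
    fun K t => ?_⟩
  rw [ProductFormula.eval, Stage.evalList]
  simp only [List.ofFn_eq_map (f := fun γ : Fin (Fintype.card ι) => _)]
  congr 2
  exact List.ofFn_getElem_eq_map l fun s => s.eval K t

/-- Product formulas of every order exist. -/
theorem exists_productFormula (p : ℕ) :
    ∃ Υ : ℕ, ∀ (ι : Type) [Fintype ι], ∃ F : ProductFormula Υ ι,
      ∀ (S : Type) [Fintype S] [DecidableEq S] (K : ι → QubitOp S), F.HasOrder p K := by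
  obtain ⟨Υ, hΥ⟩ := exists_stages p
  refine ⟨Υ, fun ι _ => ?_⟩
  obtain ⟨l, hlen, hl, hord⟩ := hΥ ι
  obtain ⟨F, hF⟩ := exists_productFormula_of_stages l hlen hl
  refine ⟨F, fun S _ _ K => ?_⟩
  have h := hord (QubitOp S) K
  unfold ProductFormula.HasOrder
  simp only [hF]
  -- The stages have order `p + 1`, one more than needed, so that `p = 0` requires no separate case.
  exact Asymptotics.IsBigO.trans h (isBigO_pow_succ (p + 1))

end Stages

/-! ### Assembly of the theorem -/

theorem theoremF2 (d : ℕ) (hd : 0 < d) (α : ℝ) :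
    -- Simulation without truncation.
    (0 ≤ α →
      -- Trotter error
      (∀ p : ℕ, 1 ≤ p → ∀ Υ : ℕ, ∃ C : ℝ, 0 < C ∧
        ∀ (Λ : Finset (Fin d → ℤ)), Λ.Nonempty →
        ∀ H : Λ × Λ → QubitOp Λ, IsPowerLaw α Λ H →
        ∀ F : ProductFormula Υ (Λ × Λ), F.HasOrder p (generators H) →
        ∀ t : ℝ, 0 ≤ t →
          ‖F.eval (generators H) t - evolution H t‖ ≤ C * errorRate d α p Λ.card t) ∧
      -- Trotter number
      (∀ p : ℕ, 1 ≤ p → ∀ Υ : ℕ, ∃ C : ℝ, 0 < C ∧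
        ∀ (Λ : Finset (Fin d → ℤ)), Λ.Nonempty →
        ∀ H : Λ × Λ → QubitOp Λ, IsPowerLaw α Λ H →
        ∀ F : ProductFormula Υ (Λ × Λ), F.HasOrder p (generators H) →
        ∀ t ε : ℝ, 0 ≤ t → 0 < ε → ∀ r : ℕ, 0 < r → C * stepRate d α p Λ.card t ε ≤ r →
          ‖F.eval (generators H) (t / r) ^ r - evolution H t‖ ≤ ε) ∧
      -- gate count of one Trotter step
      (∀ Υ : ℕ, ∃ C : ℝ, 0 < C ∧
        ∀ (Λ : Finset (Fin d → ℤ)), Λ.Nonempty →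
        ∀ H : Λ × Λ → QubitOp Λ, IsPowerLaw α Λ H →
        ∀ F : ProductFormula Υ (Λ × Λ), ∀ s : ℝ,
        ∃ c : List (QubitOp Λ), Implements c (F.eval (generators H) s) ∧
          (c.length : ℝ) ≤ C * (Λ.card : ℝ) ^ 2) ∧
      -- gate complexity
      (∀ δ : ℝ, 0 < δ → ∃ p₀ : ℕ, ∀ p : ℕ, p₀ ≤ p → ∀ (Υ : ℕ) (ε t₀ : ℝ), 0 < ε → 0 < t₀ →
        ∃ C : ℝ, 0 < C ∧
        ∀ (Λ : Finset (Fin d → ℤ)), Λ.Nonempty →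
        ∀ H : Λ × Λ → QubitOp Λ, IsPowerLaw α Λ H →
        ∀ F : ProductFormula Υ (Λ × Λ), F.HasOrder p (generators H) →
        ∀ t : ℝ, t₀ ≤ t →
        ∃ (r : ℕ) (c : List (QubitOp Λ)), 0 < r ∧
          Implements c (F.eval (generators H) (t / r) ^ r) ∧
          ‖F.eval (generators H) (t / r) ^ r - evolution H t‖ ≤ ε ∧
          (c.length : ℝ) ≤ C * gateRate d α δ Λ.card t)) ∧
    -- Simulation through the truncated Hamiltonian.
    ((d : ℝ) < α →
      -- Trotter error
      (∀ p : ℕ, 1 ≤ p → ∀ Υ : ℕ, ∃ C : ℝ, 0 < C ∧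
        ∀ (Λ : Finset (Fin d → ℤ)), Λ.Nonempty →
        ∀ H : Λ × Λ → QubitOp Λ, IsPowerLaw α Λ H →
        ∀ (ℓ : ℝ) (F : ProductFormula Υ (nearPairs Λ ℓ)),
        F.HasOrder p (generators (truncate H ℓ)) →
        ∀ t : ℝ, 0 ≤ t →
          ‖F.eval (generators (truncate H ℓ)) t - evolution (truncate H ℓ) t‖
            ≤ C * ((Λ.card : ℝ) * t ^ (p + 1))) ∧
      -- gate count of one Trotter step
      (∀ Υ : ℕ, ∃ C : ℝ, 0 < C ∧
        ∀ (Λ : Finset (Fin d → ℤ)), Λ.Nonempty →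
        ∀ H : Λ × Λ → QubitOp Λ, IsPowerLaw α Λ H →
        ∀ ℓ : ℝ, 1 ≤ ℓ → ∀ (F : ProductFormula Υ (nearPairs Λ ℓ)) (s : ℝ),
        ∃ c : List (QubitOp Λ), Implements c (F.eval (generators (truncate H ℓ)) s) ∧
          (c.length : ℝ) ≤ C * ((Λ.card : ℝ) * ℓ ^ d)) ∧
      (∃ c₀ : ℝ, 0 < c₀ ∧
        -- cutoff and Trotter number
        (∀ p : ℕ, 1 ≤ p → ∀ Υ : ℕ, ∃ C : ℝ, 0 < C ∧
          ∀ (Λ : Finset (Fin d → ℤ)), Λ.Nonempty →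
          ∀ H : Λ × Λ → QubitOp Λ, IsPowerLaw α Λ H →
          ∀ t ε : ℝ, 0 ≤ t → 0 < ε →
          ∀ ℓ : ℝ, c₀ * ((Λ.card : ℝ) * t / ε) ^ (1 / (α - d)) ≤ ℓ →
          ∀ F : ProductFormula Υ (nearPairs Λ ℓ), F.HasOrder p (generators (truncate H ℓ)) →
          ∀ r : ℕ, 0 < r →
            C * ((Λ.card : ℝ) ^ (1 / (p : ℝ)) * t ^ (1 + 1 / (p : ℝ)) / ε ^ (1 / (p : ℝ))) ≤ r →
            ‖F.eval (generators (truncate H ℓ)) (t / r) ^ r - evolution H t‖ ≤ ε) ∧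
        -- gate complexity
        (∀ δ : ℝ, 0 < δ → ∃ p₀ : ℕ, ∀ p : ℕ, p₀ ≤ p →
          ∀ (Υ : ℕ) (ε t₀ c₁ : ℝ), 0 < ε → 0 < t₀ → c₀ ≤ c₁ →
          ∃ C : ℝ, 0 < C ∧
          ∀ (Λ : Finset (Fin d → ℤ)), Λ.Nonempty →
          ∀ H : Λ × Λ → QubitOp Λ, IsPowerLaw α Λ H →
          ∀ t : ℝ, t₀ ≤ t →
          ∀ ℓ : ℝ, c₀ * ((Λ.card : ℝ) * t / ε) ^ (1 / (α - d)) ≤ ℓ →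
            ℓ ≤ c₁ * ((Λ.card : ℝ) * t / ε) ^ (1 / (α - d)) →
          ∀ F : ProductFormula Υ (nearPairs Λ ℓ), F.HasOrder p (generators (truncate H ℓ)) →
          ∃ (r : ℕ) (c : List (QubitOp Λ)), 0 < r ∧
            Implements c (F.eval (generators (truncate H ℓ)) (t / r) ^ r) ∧
            ‖F.eval (generators (truncate H ℓ)) (t / r) ^ r - evolution H t‖ ≤ ε ∧
            (c.length : ℝ) ≤ C * ((Λ.card : ℝ) * t) ^ (1 + d / (α - d) + δ)))) ∧
    -- Product formulas of every order exist.
    (∀ p : ℕ, ∃ Υ : ℕ, ∀ (ι : Type) [Fintype ι], ∃ F : ProductFormula Υ ι,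
      ∀ (Λ : Finset (Fin d → ℤ)) (K : ι → QubitOp Λ), F.HasOrder p K) := by
  refine ⟨fun hα => ⟨fun p hp Υ => ?_, fun p hp Υ => ?_, fun Υ => ?_, fun δ hδ => ?_⟩,
    fun hα => ⟨fun p hp Υ => ?_, fun Υ => ?_, ?_⟩, fun p => ?_⟩
  · obtain ⟨C, hC, h⟩ := exists_error_bound hd hα hp Υ
    refine ⟨C, hC, fun Λ hΛ H hH F hF t ht => ?_⟩
    rw [errorRate_eq d α p hΛ.card_pos]
    exact h Λ hΛ H hH (Λ × Λ) id Function.injective_id F hF t ht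
  · obtain ⟨C, hC, h⟩ := exists_step_bound hd hα hp Υ
    exact ⟨C, hC, fun Λ hΛ H hH F hF =>
      h Λ hΛ H hH (Λ × Λ) id Function.injective_id F hF⟩
  · refine ⟨Υ + 1, by positivity, fun Λ hΛ H hH F s => ?_⟩
    obtain ⟨c, hc, hlen⟩ := hH.exists_circuit id F s
    refine ⟨c, hc, ?_⟩
    rw [hlen, Fintype.card_prod, Fintype.card_coe]
    push_cast
    rw [← sq]
    gcongr
    linarith
  · exact ⟨⌈2 / δ⌉₊ + 1, fun p hp Υ ε t₀ hε ht₀ =>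
      exists_gate_complexity hd hα hδ hp Υ hε ht₀⟩
  · obtain ⟨C, hC, h⟩ := exists_error_bound (α := α) hd ((Nat.cast_nonneg d).trans hα.le) hp Υ
    refine ⟨C, hC, fun Λ hΛ H hH ℓ F hF t ht => ?_⟩
    have h1 := h Λ hΛ H hH (nearPairs Λ ℓ) Subtype.val Subtype.val_injective F hF t ht
    rwa [rowRate, if_neg hα.not_gt, if_neg hα.ne', one_pow, mul_one] at h1
  · exact exists_truncated_gate_count d α Υ
  · obtain ⟨c₀, hc₀, hstep⟩ := exists_truncated_step_bound hd hα
    refine ⟨c₀, hc₀, hstep, fun δ hδ => ⟨⌈2 / δ⌉₊ + 1, fun p hp Υ ε t₀ c₁ hε ht₀ hc₁ => ?_⟩⟩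
    obtain ⟨C, hC, hnum⟩ := hstep p (by omega) Υ
    obtain ⟨D, hD, hgate⟩ := exists_truncated_gate_complexity hα hδ hp Υ hε ht₀ hC
      (hc₀.trans_le hc₁)
    refine ⟨D, hD, fun Λ hΛ H hH t ht ℓ hℓ hℓ' F hF => ?_⟩
    have ht' : 0 ≤ t := ht₀.le.trans ht
    have hℓ0 : 0 ≤ ℓ := le_trans (by positivity) hℓ
    obtain ⟨r, hr, hCr, c, hc, hlen⟩ := hgate Λ hΛ H hH t ht ℓ hℓ0 hℓ' F
    exact ⟨r, c, hr, hc, hnum Λ hΛ H hH t ε ht' hε ℓ hℓ F hF r hr hCr, hlen⟩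
  · obtain ⟨Υ, h⟩ := exists_productFormula p
    refine ⟨Υ, fun ι _ => ?_⟩
    obtain ⟨F, hF⟩ := h ι
    exact ⟨F, fun Λ K => hF Λ K⟩
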